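/- **Setting and notation.** For each $n\in\mathbb N$ let $(\Omega_n,\mathcal F_n,P_n)$ be a probability space, $d=d_n\ge 2$ an integer, and $Y=(Y_t)_{t\in[0,1]}$ an $\mathbb R^{d}$-valued process with quadratic covariation matrix $\Sigma_Y=[Y,Y]_1$ (for instance a semimartingale), i.e. $\Sigma_Y$ is a random $d\times d$ matrix such that $\sum_l (Y^i_{t_{l+1}}-Y^i_{t_l})(Y^j_{t_{l+1}}-Y^j_{t_l})\to\Sigma_Y^{ij}$ in probability for all $i,j$ along every sequence of partitions of $[0,1]$ whose mesh tends to $0$. Assume $\Sigma_Y$ is a.s. invertible and put $\Theta_Y=\Sigma_Y^{-1}$. Let $\hat\Sigma_n$ be a random $d\times d$ matrix which is a.s. symmetric positive semidefinite with positive diagonal entries. (The index $n$ is suppressed in $d$, $Y$, $\Sigma_Y$, $\Theta_Y$, $P$.) For $\lambda>0$ the weighted graphical Lasso estimator is $$\hat\Theta_\lambda=\operatorname*{arg\,min}_{\Theta\ \text{symmetric positive definite}}\Big\{\operatorname{tr}(\Theta\hat\Sigma_n)-\log\det\Theta+\lambda\sum_{i\ne j}\sqrt{\hat\Sigma_n^{ii}}\sqrt{\hat\Sigma_n^{jj}}\,|\Theta^{ij}|\Big\}.$$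 Write $\|A\|_{\ell_\infty}=\max_{i,j}|A^{ij}|$, and $|||A|||_\infty=\max_i\sum_j|A^{ij}|$ for the operator norm of $A$ with respect to sup norms. For a symmetric $A$ let $\Lambda_{\max}(A),\Lambda_{\min}(A)$ be its extreme eigenvalues, $s(A)=\#\{(i,j):i\ne j,\ A^{ij}\neq0\}$ and $\mathfrak d(A)=\max_j\#\{i\ne j:A^{ij}\ne0\}$. $\operatorname{vec}$ denotes column-wise vectorization, $\otimes$ the Kronecker product, and inequalities between vectors are componentwise. $O_p$ and $\to^p$ are understood as $n\to\infty$. **Assumptions.** Let $s_n,\mathfrak d_n\in[1,\infty)$ be deterministic sequences and let $\lambda_n$ be a.s. positive random variables such that * $\Lambda_{\max}(\Sigma_Y)+1/\Lambda_{\min}(\Sigma_Y)=O_p(1)$, $\ s(\Theta_Y)=O_p(s_n)$, $\ \mathfrak d(\Theta_Y)=O_p(\mathfrak d_n)$; * $\lambda_n^{-1}\|\hat\Sigma_n-\Sigma_Y\|_{\ell_\infty}\to^p0$ and $s_n\lambda_n\to^p0$. For every $n$ let $a_n>0$ be deterministic, $\mathfrak C_n$ an a.s. positive semidefinite $d^2\times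 d^2$ random matrix and $J_n$ an $m\times d^2$ random matrix, where $m=m_n$ may depend on $n$. Set $\tilde J_n=-J_n(\Theta_Y\otimes\Theta_Y)$, and let $\zeta_n$ be a $d^2$-dimensional standard Gaussian vector independent of $\mathcal F_n$ (defined on an extension of the probability space). Assume that $$a_n|||J_n|||_\infty\,\lambda_n^2\,s_n\sqrt{\mathfrak d_n\log(m+1)}\to^p0,$$ $$\lim_{n\to\infty}\sup_{y\in\mathbb R^m}\Big|P\big(a_n\tilde J_n\operatorname{vec}(\hat\Sigma_n-\Sigma_Y)\le y\big)-P\big(\tilde J_n\mathfrak C_n^{1/2}\zeta_n\le y\big)\Big|=0,$$ $$\lim_{b\downarrow0}\limsup_{n\to\infty}P\Big(\min_{1\le k\le m}(\tilde J_n\mathfrak C_n\tilde J_n^\top)^{kk}<b\Big)=0.$$ **Proposition 3.2.** Put $\Gamma_n=-(\hat\Theta_{\lambda_n}-\hat\Theta_{\lambda_n}\hat\Sigma_n\hat\Theta_{\lambda_n})$. Then $$\lim_{n\to\infty}\sup_{y\in\mathbb R^m}\Big|P\big(a_nJ_n\operatorname{vec}(\hat\Theta_{\lambda_n}-\Gamma_n-\Theta_Y)\le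 y\big)-P\big(\tilde J_n\mathfrak C_n^{1/2}\zeta_n\le y\big)\Big|=0.$$ -/

import Mathlib

open MeasureTheory ProbabilityTheory Filter Topology
open scoped ENNReal Kronecker MatrixOrder

noncomputable section

namespace WGLasso

/-! ### Matrix quantities -/

/-- The entrywise maximum norm `max_{i,j} |A i j|`. -/
def maxNorm {ι κ : Type*} (A : Matrix ι κ ℝ) : ℝ := ⨆ i, ⨆ j, |A i j|

/-- The operator norm of `x ↦ A x` for the sup norms on domain and codomain
(`ι → ℝ` and `κ → ℝ` carry the sup norm in Mathlib). -/
def opNormInf {ι κ : Type*} [Fintype ι] [Fintype κ] [DecidableEq κ] (A : Matrix ι κ ℝ) : ℝ :=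
  ‖LinearMap.toContinuousLinearMap (Matrix.toLin' A)‖

/-- Largest eigenvalue of a symmetric matrix. -/
def lambdaMax {d : ℕ} (A : Matrix (Fin d) (Fin d) ℝ) : ℝ := sSup (spectrum ℝ A)

/-- Smallest eigenvalue of a symmetric matrix. -/
def lambdaMin {d : ℕ} (A : Matrix (Fin d) (Fin d) ℝ) : ℝ := sInf (spectrum ℝ A)

open Classical in
/-- The number `s(A)` of non-zero off-diagonal entries of `A`. -/
def sparsity {d : ℕ} (A : Matrix (Fin d) (Fin d) ℝ) : ℕ :=
  (Finset.univ.filter fun p : Fin d × Fin d => A p.1 p.2 ≠ 0 ∧ p.1 ≠ p.2).card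

open Classical in
/-- The maximal number of non-zero off-diagonal entries in a column of `A`. -/
def maxDegree {d : ℕ} (A : Matrix (Fin d) (Fin d) ℝ) : ℕ :=
  Finset.univ.sup fun j : Fin d => (Finset.univ.filter fun i : Fin d => A i j ≠ 0 ∧ i ≠ j).card

/-! ### The weighted graphical Lasso and its bias correction -/

/-- Objective function of the weighted graphical Lasso based on the covariance estimate `S`;
the weights are the square roots of the diagonal entries of `S`. -/
def objective {d : ℕ} (S : Matrix (Fin d) (Fin d) ℝ) (lam : ℝ)
    (Θ : Matrix (Fin d) (Fin d) ℝ) : ℝ :=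
  (Θ * S).trace - Real.log Θ.det +
    lam * ∑ i, ∑ j, if i ≠ j then √(S i i) * √(S j j) * |Θ i j| else 0

/-- `Θ` minimizes the objective over the positive definite matrices. -/
def IsMinimizer {d : ℕ} (S : Matrix (Fin d) (Fin d) ℝ) (lam : ℝ)
    (Θ : Matrix (Fin d) (Fin d) ℝ) : Prop :=
  Θ.PosDef ∧ ∀ Θ' : Matrix (Fin d) (Fin d) ℝ, Θ'.PosDef → objective S lam Θ ≤ objective S lam Θ'

open Classical in
/-- The weighted graphical Lasso estimator: the minimizer of the objective over the positive
definite matrices. (It exists and is unique when `lam > 0` and `S` is positive semidefinite with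
positive diagonal; the value is set to `0` when there is no minimizer.) -/
def estimator {d : ℕ} (S : Matrix (Fin d) (Fin d) ℝ) (lam : ℝ) : Matrix (Fin d) (Fin d) ℝ :=
  if h : ∃ Θ, IsMinimizer S lam Θ then h.choose else 0

/-- The bias term `Γ = -(Θ̂ - Θ̂ S Θ̂)`, where `Θ̂` is the weighted graphical Lasso estimator. -/
def bias {d : ℕ} (S : Matrix (Fin d) (Fin d) ℝ) (lam : ℝ) : Matrix (Fin d) (Fin d) ℝ :=
  -(estimator S lam - estimator S lam * S * estimator S lam)

/-- `J̃ = -J (Θ ⊗ Θ)`. The coordinates of `vec A` for a `d × d` matrix `A` are indexed by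
`Fin d × Fin d`, as in `Matrix.vec`. -/
def tildeJ {m d : ℕ} (J : Matrix (Fin m) (Fin d × Fin d) ℝ) (Θ : Matrix (Fin d) (Fin d) ℝ) :
    Matrix (Fin m) (Fin d × Fin d) ℝ :=
  -(J * (Θ ⊗ₖ Θ))

/-! ### Probability -/

/-- `X n = O_p(a n)`, where `X n` is defined on a probability space that may depend on `n`. -/
def BigOp {Ω : ℕ → Type*} [∀ n, MeasurableSpace (Ω n)] (P : ∀ n, Measure (Ω n))
    (X : ∀ n, Ω n → ℝ) (a : ℕ → ℝ) : Prop :=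
  ∀ ε : ℝ≥0∞, 0 < ε → ∃ M : ℝ, ∀ᶠ n in atTop, P n {ω | M * a n < |X n ω|} ≤ ε

/-- `X n → 0` in probability, where `X n` is defined on a probability space that may depend
on `n`. -/
def TendstoZeroInProb {Ω : ℕ → Type*} [∀ n, MeasurableSpace (Ω n)] (P : ∀ n, Measure (Ω n))
    (X : ∀ n, Ω n → ℝ) : Prop :=
  ∀ ε : ℝ, 0 < ε → Tendsto (fun n => P n {ω | ε ≤ |X n ω|}) atTop (𝓝 0)

/-- `Q` is (a version of) the quadratic covariation matrix `[Y, Y]_1` of the `d`-dimensional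
process `Y = (Y_t)_{t ∈ [0,1]}`: for every sequence of partitions
`0 = t k 0 ≤ t k 1 ≤ ... ≤ t k (N k) = 1` of `[0,1]` with mesh tending to `0`, the sums of products
of increments of `Y^i` and `Y^j` converge to `Q^{ij}` in probability. -/
def IsQuadCov {Ω : Type*} [MeasurableSpace Ω] (P : Measure Ω) {d : ℕ}
    (Y : unitInterval → Ω → Fin d → ℝ) (Q : Ω → Matrix (Fin d) (Fin d) ℝ) : Prop :=
  ∀ (N : ℕ → ℕ) (t : ℕ → ℕ → unitInterval),
    (∀ k, t k 0 = 0 ∧ Monotone (t k) ∧ t k (N k) = 1) →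
    (∀ ε : ℝ, 0 < ε → ∀ᶠ k in atTop, ∀ l < N k, (t k (l + 1) : ℝ) - (t k l : ℝ) < ε) →
    ∀ i j : Fin d, TendstoInMeasure P
      (fun k ω => ∑ l ∈ Finset.range (N k),
        (Y (t k (l + 1)) ω i - Y (t k l) ω i) * (Y (t k (l + 1)) ω j - Y (t k l) ω j))
      atTop (fun ω => Q ω i j)

/-- The probability `P(X ≤ y)` (componentwise inequality). -/
def orthantProb {Ω : Type*} [MeasurableSpace Ω] (P : Measure Ω) {m : ℕ}
    (X : Ω → Fin m → ℝ) (y : Fin m → ℝ) : ℝ :=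
  P.real {ω | ∀ k, X ω k ≤ y k}

/-- The probability `P(A C^{1/2} ζ ≤ y)` (componentwise inequality), where `A` and `C` are random
matrices on `(Ω, P)` and `ζ` is a standard Gaussian vector independent of the σ-algebra of `Ω`,
realized as the second coordinate on the extension `Ω × ℝ^κ` of `Ω` with measure
`P ⊗ N(0, I)`. Here `CFC.sqrt` is the positive semidefinite square root. -/
def mixedNormalProb {Ω : Type*} [MeasurableSpace Ω] (P : Measure Ω) {m : ℕ}
    {κ : Type*} [Fintype κ] [DecidableEq κ]
    (A : Ω → Matrix (Fin m) κ ℝ) (C : Ω → Matrix κ κ ℝ) (y : Fin m → ℝ) : ℝ :=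
  (P.prod (Measure.pi fun _ : κ => gaussianReal 0 1)).real
    {p : Ω × (κ → ℝ) | ∀ k, (A p.1 * CFC.sqrt (C p.1)).mulVec p.2 k ≤ y k}

end WGLasso

end

noncomputable section

namespace WGLasso

/-! ### Anti-concentration of Gaussian vectors -/

section Gaussian

variable {κ : Type*} [Fintype κ]

/-- The standard Gaussian measure on `κ → ℝ`. -/
abbrev stdGauss (κ : Type*) [Fintype κ] : Measure (κ → ℝ) :=
  Measure.pi fun _ : κ => gaussianReal 0 1

lemma gaussianReal_eq_withDensity_exp (a : ℝ) :
    gaussianReal a 1 =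
      (gaussianReal 0 1).withDensity fun x => ENNReal.ofReal (Real.exp (a * x - a ^ 2 / 2)) := by
  rw [gaussianReal_of_var_ne_zero _ one_ne_zero, gaussianReal_of_var_ne_zero _ one_ne_zero,
    ← withDensity_mul _ (measurable_gaussianPDF _ _) (by fun_prop)]
  congr 1
  ext x
  simp only [Pi.mul_apply, gaussianPDF]
  rw [← ENNReal.ofReal_mul (gaussianPDFReal_nonneg _ _ _)]
  congr 1
  simp only [gaussianPDFReal]
  rw [mul_assoc _ (Real.exp _), ← Real.exp_add]
  congr 2
  simp
  ring

lemma integrable_exp_gaussianReal (a : ℝ) :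
    Integrable (fun x => Real.exp (a * x - a ^ 2 / 2)) (gaussianReal 0 1) := by
  simp_rw [sub_eq_add_neg, Real.exp_add]
  exact (integrable_exp_mul_gaussianReal a).mul_const _

lemma pi_gaussianReal_eq_withDensity (v : κ → ℝ) :
    Measure.pi (fun i => gaussianReal (v i) 1) =
      (stdGauss κ).withDensity
        fun x => ENNReal.ofReal (∏ i, Real.exp (v i * x i - v i ^ 2 / 2)) := by
  refine (Measure.pi_eq fun s hs => ?_)
  rw [withDensity_apply _ (MeasurableSet.univ_pi hs), ← lintegral_indicator (MeasurableSet.univ_pi hs)]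
  set f : κ → ℝ → ℝ := fun i x => (s i).indicator (fun x => Real.exp (v i * x - v i ^ 2 / 2)) x
  have hf0 : ∀ i x, 0 ≤ f i x := fun i x =>
    Set.indicator_nonneg (fun _ _ => (Real.exp_pos _).le) _
  have hfi : ∀ i, Integrable (f i) (gaussianReal 0 1) := fun i =>
    (integrable_exp_gaussianReal (v i)).indicator (hs i)
  have h1 : ∀ x : κ → ℝ, (Set.univ.pi s).indicator
      (fun x => ENNReal.ofReal (∏ i, Real.exp (v i * x i - v i ^ 2 / 2))) x =
      ENNReal.ofReal (∏ i, f i (x i)) := by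
    intro x
    by_cases hx : x ∈ Set.univ.pi s
    · rw [Set.indicator_of_mem hx]
      congr 1
      exact Finset.prod_congr rfl fun i _ => (Set.indicator_of_mem (hx i trivial)
        fun x => Real.exp (v i * x - v i ^ 2 / 2)).symm
    · rw [Set.indicator_of_notMem hx]
      simp only [Set.mem_pi, Set.mem_univ, true_imp_iff, not_forall] at hx
      obtain ⟨i, hi⟩ := hx
      rw [Finset.prod_eq_zero (Finset.mem_univ i) (Set.indicator_of_notMem hi _), ENNReal.ofReal_zero]
  simp_rw [h1]
  rw [← ofReal_integral_eq_lintegral_ofReal (Integrable.fintype_prod hfi)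
    (Eventually.of_forall fun x => Finset.prod_nonneg fun i _ => hf0 i _),
    integral_fintype_prod_eq_prod, ENNReal.ofReal_prod_of_nonneg
      fun i _ => integral_nonneg (hf0 i)]
  refine Finset.prod_congr rfl fun i _ => ?_
  rw [ofReal_integral_eq_lintegral_ofReal (hfi i) (Eventually.of_forall (hf0 i)),
    gaussianReal_eq_withDensity_exp (v i), withDensity_apply _ (hs i), ← lintegral_indicator (hs i)]
  congr 1
  ext x
  by_cases hx : x ∈ s i <;> simp [f, hx]

/-- Quasi-invariance of the standard Gaussian measure under translations. -/
lemma stdGauss_translate_ge {S : Set (κ → ℝ)} (hS : MeasurableSet S) (v : κ → ℝ) (c : ℝ)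
    (hc : ∀ x ∈ S, v ⬝ᵥ x ≤ c) :
    Real.exp (-c - v ⬝ᵥ v / 2) * (stdGauss κ).real S ≤ (stdGauss κ).real {x | x - v ∈ S} := by
  have hmap : (stdGauss κ).map (fun x => x - v) = Measure.pi (fun i => gaussianReal (-v i) 1) := by
    have := Measure.pi_map_pi (μ := fun _ : κ => gaussianReal 0 1) (f := fun i x => x + -v i)
      (fun i => by fun_prop)
    simp only [gaussianReal_map_add_const, zero_add] at this
    rw [← this]
    rfl
  have h1 : (stdGauss κ) {x | x - v ∈ S} = ∫⁻ x in S,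
      ENNReal.ofReal (∏ i, Real.exp (-v i * x i - (-v i) ^ 2 / 2)) ∂(stdGauss κ) := by
    rw [← withDensity_apply _ hS, ← pi_gaussianReal_eq_withDensity, ← hmap,
      Measure.map_apply (by fun_prop) hS]
    rfl
  have h2 : ENNReal.ofReal (Real.exp (-c - v ⬝ᵥ v / 2)) * (stdGauss κ) S ≤
      (stdGauss κ) {x | x - v ∈ S} := by
    rw [h1, ← setLIntegral_const]
    refine setLIntegral_mono_ae' hS (Eventually.of_forall fun x hx => ENNReal.ofReal_le_ofReal ?_)
    rw [← Real.exp_sum, Real.exp_le_exp]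
    have : ∑ i, (-v i * x i - (-v i) ^ 2 / 2) = - (v ⬝ᵥ x) - v ⬝ᵥ v / 2 := by
      simp only [dotProduct, Finset.sum_sub_distrib, Finset.sum_div, ← Finset.sum_neg_distrib]
      congr 1 <;> exact Finset.sum_congr rfl fun i _ => by ring
    rw [this]
    linarith [hc x hx]
  have h3 := ENNReal.toReal_mono (measure_ne_top _ _) h2
  rwa [ENNReal.toReal_mul, ENNReal.toReal_ofReal (Real.exp_pos _).le] at h3

/-- A slab far from the origin has small Gaussian measure. -/
lemma stdGauss_slab_le (u : κ → ℝ) (hu : u ⬝ᵥ u = 1) {T y δ : ℝ} (hT : 1 ≤ T) (hy : T ≤ y)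
    (hδ : 0 < δ) (hδ1 : δ ≤ 1) :
    (stdGauss κ).real {x | y < u ⬝ᵥ x ∧ u ⬝ᵥ x ≤ y + δ} ≤ 4 * δ * Real.exp (-(T ^ 2 / 2)) := by
  have hmeas : Measurable fun x : κ → ℝ => u ⬝ᵥ x := by unfold dotProduct; fun_prop
  set S : Set (κ → ℝ) := {x | y < u ⬝ᵥ x ∧ u ⬝ᵥ x ≤ y + δ} with hSdef
  have hS : MeasurableSet S :=
    (measurableSet_lt measurable_const hmeas).inter (measurableSet_le hmeas measurable_const)
  set N := ⌊1 / δ⌋₊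
  have hN1 : (N : ℝ) ≤ 1 / δ := Nat.floor_le (by positivity)
  have hN2 : 1 / δ < N + 1 := Nat.lt_floor_add_one _
  have hN3 : 1 ≤ (N : ℝ) := by
    have : 1 ≤ N := Nat.le_floor (by simpa using (one_le_div hδ).2 hδ1)
    exact_mod_cast this
  have hN4 : 1 ≤ 2 * (N * δ) := by
    rw [div_lt_iff₀ hδ] at hN2
    nlinarith
  set τ : Fin N → ℝ := fun j => T - 1 + j * δ
  set U : Fin N → Set (κ → ℝ) := fun j => {x | x - (-τ j) • u ∈ S}
  have hUm : ∀ j, MeasurableSet (U j) := fun j => hS.preimage (by fun_prop)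
  have hUval : ∀ j x, x ∈ U j ↔ y - τ j < u ⬝ᵥ x ∧ u ⬝ᵥ x ≤ y - τ j + δ := by
    intro j x
    simp only [U, hSdef, Set.mem_ofPred_eq, dotProduct_sub, dotProduct_smul, hu, smul_eq_mul]
    constructor <;> rintro ⟨h1, h2⟩ <;> constructor <;> linarith
  have hdisj : Pairwise (Function.onFun Disjoint U) := by
    intro i j hij
    wlog h : i < j generalizing i j
    · exact (this hij.symm (lt_of_le_of_ne (not_lt.1 h) hij.symm)).symm
    rw [Function.onFun, Set.disjoint_left]
    intro x hi hj
    rw [hUval] at hi hj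
    have : (i : ℝ) + 1 ≤ j := by exact_mod_cast h
    have h3 : ((i : ℝ) + 1) * δ ≤ j * δ := by gcongr
    simp only [τ] at hi hj
    linarith [hi.1, hj.2]
  have hge : ∀ j, Real.exp ((T ^ 2 - 1) / 2) * (stdGauss κ).real S ≤ (stdGauss κ).real (U j) := by
    intro j
    have hj : ((j : ℕ) : ℝ) * δ ≤ 1 := by
      have : ((j : ℕ) : ℝ) ≤ 1 / δ := le_trans (by exact_mod_cast j.2.le) hN1
      rwa [le_div_iff₀ hδ] at this
    have hj0 : 0 ≤ ((j : ℕ) : ℝ) * δ := by positivity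
    have hτ0 : 0 ≤ τ j := by simp only [τ]; linarith
    refine le_trans ?_ (stdGauss_translate_ge hS ((-τ j) • u) (-τ j * T) ?_)
    · gcongr
      simp only [dotProduct_smul, smul_dotProduct, hu, smul_eq_mul, τ]
      nlinarith
    · intro x hx
      simp only [smul_dotProduct, smul_eq_mul]
      have : T ≤ u ⬝ᵥ x := hy.trans hx.1.le
      nlinarith
  have hsum : ∑ j, (stdGauss κ).real (U j) ≤ 1 := by
    rw [← measureReal_iUnion_fintype hdisj hUm]
    exact measureReal_le_one
  have h5 : N * (Real.exp ((T ^ 2 - 1) / 2) * (stdGauss κ).real S) ≤ 1 := by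
    refine le_trans (le_of_eq ?_) ((Finset.sum_le_sum fun j _ => hge j).trans hsum)
    simp
  have he : Real.exp ((T ^ 2 - 1) / 2) = Real.exp (T ^ 2 / 2) * Real.exp (-(1 / 2)) := by
    rw [← Real.exp_add]; congr 1; ring
  have he2 : 1 / 2 ≤ Real.exp (-(1 / 2)) := by
    have := Real.add_one_le_exp (-(1 / 2) : ℝ)
    linarith
  rw [Real.exp_neg, ← div_eq_mul_inv, le_div_iff₀ (Real.exp_pos _)]
  have hq : 0 ≤ (stdGauss κ).real S * Real.exp (T ^ 2 / 2) := by positivity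
  rw [he] at h5
  have h6 : N * (1 / 2 * ((stdGauss κ).real S * Real.exp (T ^ 2 / 2))) ≤ 1 := by
    refine le_trans ?_ h5
    have : 1 / 2 * ((stdGauss κ).real S * Real.exp (T ^ 2 / 2)) ≤
        Real.exp (-(1 / 2)) * ((stdGauss κ).real S * Real.exp (T ^ 2 / 2)) := by gcongr
    calc _ ≤ N * (Real.exp (-(1 / 2)) * ((stdGauss κ).real S * Real.exp (T ^ 2 / 2))) := by gcongr
      _ = _ := by ring
  set q := (stdGauss κ).real S * Real.exp (T ^ 2 / 2)
  nlinarith [mul_le_mul_of_nonneg_right hN4 hq]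

/-- The cells of the boundary layer of a polytope, near the origin, have small total measure. -/
lemma sum_stdGauss_cell_le {m : ℕ} (u : Fin m → κ → ℝ) (hu : ∀ k, u k ⬝ᵥ u k = 1)
    (y : Fin m → ℝ) {T δ : ℝ} (hT : 1 ≤ T) (hδ : 0 < δ) (hTδ : T * δ ≤ 1) :
    ∑ k with y k < T, (stdGauss κ).real {x | (y k < u k ⬝ᵥ x ∧ u k ⬝ᵥ x ≤ y k + δ) ∧
      (∀ l, u l ⬝ᵥ x - y l ≤ u k ⬝ᵥ x - y k) ∧ ∀ l < k, u l ⬝ᵥ x - y l < u k ⬝ᵥ x - y k} ≤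
      26 * T * δ := by
  have hmeas : ∀ k, Measurable fun x : κ → ℝ => u k ⬝ᵥ x := fun k => by
    unfold dotProduct; fun_prop
  have hT0 : 0 < T := by linarith
  set S : Fin m → Set (κ → ℝ) := fun k => {x | (y k < u k ⬝ᵥ x ∧ u k ⬝ᵥ x ≤ y k + δ) ∧
      (∀ l, u l ⬝ᵥ x - y l ≤ u k ⬝ᵥ x - y k) ∧ ∀ l < k, u l ⬝ᵥ x - y l < u k ⬝ᵥ x - y k}
    with hSdef
  have hS : ∀ k, MeasurableSet (S k) := fun k => by
    have h2 : S k = ({x | y k < u k ⬝ᵥ x} ∩ {x | u k ⬝ᵥ x ≤ y k + δ}) ∩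
        ((⋂ l, {x | u l ⬝ᵥ x - y l ≤ u k ⬝ᵥ x - y k}) ∩
          ⋂ l, ⋂ (_ : l < k), {x | u l ⬝ᵥ x - y l < u k ⬝ᵥ x - y k}) := by
      ext x; simp [S]
    rw [h2]
    exact ((measurableSet_lt measurable_const (hmeas k)).inter
      (measurableSet_le (hmeas k) measurable_const)).inter
      ((MeasurableSet.iInter fun l => measurableSet_le ((hmeas l).sub_const _)
        ((hmeas k).sub_const _)).inter (MeasurableSet.iInter fun l => MeasurableSet.iInter fun _ =>
        measurableSet_lt ((hmeas l).sub_const _) ((hmeas k).sub_const _)))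
  set N := ⌊1 / (T * δ)⌋₊
  have hTd : 0 < T * δ := by positivity
  have hN1 : (N : ℝ) ≤ 1 / (T * δ) := Nat.floor_le (by positivity)
  have hN2 : 1 / (T * δ) < N + 1 := Nat.lt_floor_add_one _
  have hN3 : 1 ≤ (N : ℝ) := by
    have : 1 ≤ N := Nat.le_floor (by simpa using (one_le_div hTd).2 hTδ)
    exact_mod_cast this
  have hN4 : 1 ≤ 2 * (N * (T * δ)) := by
    rw [div_lt_iff₀ hTd] at hN2
    nlinarith
  set U : Fin m × Fin N → Set (κ → ℝ) := fun p => {x | x - ((p.2 : ℕ) * δ : ℝ) • u p.1 ∈ S p.1}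
  have hUm : ∀ p, MeasurableSet (U p) := fun p => (hS p.1).preimage (by fun_prop)
  have hle1 : ∀ k l, u l ⬝ᵥ u k ≤ 1 := by
    intro k l
    have h : 0 ≤ (u l - u k) ⬝ᵥ (u l - u k) := by
      simp only [dotProduct]
      exact Finset.sum_nonneg fun i _ => mul_self_nonneg _
    simp only [dotProduct_sub, sub_dotProduct, hu, dotProduct_comm (u k) (u l)] at h
    linarith
  have hUval : ∀ p x, x ∈ U p →
      (((p.2 : ℕ) : ℝ) * δ < u p.1 ⬝ᵥ x - y p.1 ∧ u p.1 ⬝ᵥ x - y p.1 ≤ ((p.2 : ℕ) : ℝ) * δ + δ) ∧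
      (∀ l, u l ⬝ᵥ x - y l ≤ u p.1 ⬝ᵥ x - y p.1) ∧
        ∀ l < p.1, u l ⬝ᵥ x - y l < u p.1 ⬝ᵥ x - y p.1 := by
    rintro ⟨k, j⟩ x hx
    simp only [U, hSdef, Set.mem_ofPred_eq, dotProduct_sub, dotProduct_smul, hu, smul_eq_mul] at hx
    have hj0 : 0 ≤ ((j : ℕ) : ℝ) * δ := by positivity
    obtain ⟨⟨h1, h2⟩, h3, h4⟩ := hx
    refine ⟨⟨by linarith, by linarith⟩, fun l => ?_, fun l hl => ?_⟩
    · have := h3 l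
      nlinarith [hle1 k l]
    · have := h4 l hl
      nlinarith [hle1 k l]
  have hdisj : Pairwise (Function.onFun Disjoint U) := by
    intro p q hpq
    rw [Function.onFun, Set.disjoint_left]
    intro x hp hq
    obtain ⟨⟨p1, p2⟩, p3, p4⟩ := hUval p x hp
    obtain ⟨⟨q1, q2⟩, q3, q4⟩ := hUval q x hq
    have h1 : p.1 = q.1 := by
      rcases lt_trichotomy p.1 q.1 with h | h | h
      · exact absurd (q4 _ h) (not_lt.2 (p3 _))
      · exact h
      · exact absurd (p4 _ h) (not_lt.2 (q3 _))
    rw [h1] at p1 p2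
    have h2 : ((p.2 : ℕ) : ℝ) < ((q.2 : ℕ) : ℝ) + 1 := by
      have : ((p.2 : ℕ) : ℝ) * δ < (((q.2 : ℕ) : ℝ) + 1) * δ := by linarith
      exact lt_of_mul_lt_mul_right this hδ.le
    have h3 : ((q.2 : ℕ) : ℝ) < ((p.2 : ℕ) : ℝ) + 1 := by
      have : ((q.2 : ℕ) : ℝ) * δ < (((p.2 : ℕ) : ℝ) + 1) * δ := by linarith
      exact lt_of_mul_lt_mul_right this hδ.le
    have h4 : (p.2 : ℕ) < (q.2 : ℕ) + 1 := by exact_mod_cast h2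
    have h5 : (q.2 : ℕ) < (p.2 : ℕ) + 1 := by exact_mod_cast h3
    exact hpq (Prod.ext h1 (Fin.ext (by omega)))
  have hge : ∀ p : Fin m × Fin N, y p.1 < T →
      Real.exp (-(5 / 2)) * (stdGauss κ).real (S p.1) ≤ (stdGauss κ).real (U p) := by
    rintro ⟨k, j⟩ hk
    have hj0 : 0 ≤ ((j : ℕ) : ℝ) * δ := by positivity
    have hj : T * (((j : ℕ) : ℝ) * δ) ≤ 1 := by
      have : ((j : ℕ) : ℝ) ≤ 1 / (T * δ) := le_trans (by exact_mod_cast j.2.le) hN1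
      rw [le_div_iff₀ hTd] at this
      linarith
    have hj1 : ((j : ℕ) : ℝ) * δ ≤ 1 := by nlinarith
    have hd1 : δ ≤ 1 := by nlinarith
    refine le_trans ?_ (stdGauss_translate_ge (hS k) (((j : ℕ) * δ : ℝ) • u k)
      (((j : ℕ) * δ : ℝ) * (T + δ)) ?_)
    · gcongr
      simp only [dotProduct_smul, smul_dotProduct, hu, smul_eq_mul]
      set t := ((j : ℕ) : ℝ) * δ
      have ht : t * δ ≤ 1 := by nlinarith
      nlinarith
    · intro x hx
      simp only [smul_dotProduct, smul_eq_mul]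
      have hk' : y k < T := hk
      have : u k ⬝ᵥ x ≤ T + δ := by linarith [hx.1.2]
      gcongr
  have hsum : ∑ p, (stdGauss κ).real (U p) ≤ 1 := by
    rw [← measureReal_iUnion_fintype hdisj hUm]
    exact measureReal_le_one
  have h5 : N * (Real.exp (-(5 / 2)) * ∑ k with y k < T, (stdGauss κ).real (S k)) ≤ 1 := by
    refine le_trans ?_ hsum
    rw [Fintype.sum_prod_type, Finset.mul_sum, Finset.mul_sum]
    refine le_trans (Finset.sum_le_sum (g := fun k => ∑ j, (stdGauss κ).real (U (k, j))) ?_)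
      (Finset.sum_le_sum_of_subset_of_nonneg (Finset.filter_subset _ _) fun k _ _ =>
        Finset.sum_nonneg fun j _ => measureReal_nonneg)
    intro k hk
    refine le_trans (le_of_eq ?_) (Finset.sum_le_sum fun j _ =>
      hge (k, j) (Finset.mem_filter.1 hk).2)
    simp
  have he : 1 / 13 ≤ Real.exp (-(5 / 2)) := by
    rw [Real.exp_neg, ← one_div]
    apply one_div_le_one_div_of_le (Real.exp_pos _)
    have h := Real.exp_one_lt_d9
    have h2 : Real.exp (5 / 2) ^ 2 = Real.exp 1 ^ 5 := by
      rw [← Real.exp_nat_mul, ← Real.exp_nat_mul]; norm_num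
    have h3 : Real.exp 1 ^ 5 ≤ 13 ^ 2 := by
      calc Real.exp 1 ^ 5 ≤ 2.7182818286 ^ 5 := by gcongr
        _ ≤ 13 ^ 2 := by norm_num
    rw [← h2] at h3
    exact le_of_sq_le_sq h3 (by norm_num)
  set Q := ∑ k with y k < T, (stdGauss κ).real (S k)
  have hQ : 0 ≤ Q := Finset.sum_nonneg fun _ _ => measureReal_nonneg
  have h6 : N * (1 / 13 * Q) ≤ 1 := le_trans (by gcongr) h5
  nlinarith [mul_le_mul_of_nonneg_right hN4 hQ]

/-- **Nazarov's inequality** (anti-concentration of Gaussian vectors on orthants) for unit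
variances. -/
lemma stdGauss_layer_le_of_unit {m : ℕ} (hm : 1 ≤ m) (u : Fin m → κ → ℝ)
    (hu : ∀ k, u k ⬝ᵥ u k = 1) (y : Fin m → ℝ) {δ : ℝ} (hδ : 0 < δ) :
    (stdGauss κ).real {x | (∀ k, u k ⬝ᵥ x ≤ y k + δ) ∧ ¬ ∀ k, u k ⬝ᵥ x ≤ y k} ≤
      45 * √(Real.log (m + 1)) * δ := by
  set T := √(2 * Real.log (m + 1)) with hTdef
  have hlog : 1 / 2 ≤ Real.log (m + 1) := by
    have h2 : Real.log 2 ≤ Real.log (m + 1) := by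
      apply Real.log_le_log (by norm_num)
      have : (1 : ℝ) ≤ m := by exact_mod_cast hm
      linarith
    linarith [Real.log_two_gt_d9]
  have hT : 1 ≤ T := by
    rw [hTdef, Real.one_le_sqrt]; linarith
  have hT2 : T ^ 2 = 2 * Real.log (m + 1) := Real.sq_sqrt (by linarith)
  have hTle : T ≤ 3 / 2 * √(Real.log (m + 1)) := by
    rw [hTdef, Real.sqrt_mul (by norm_num)]
    gcongr
    rw [Real.sqrt_le_left (by norm_num)]; norm_num
  suffices h : (stdGauss κ).real {x | (∀ k, u k ⬝ᵥ x ≤ y k + δ) ∧ ¬ ∀ k, u k ⬝ᵥ x ≤ y k} ≤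
      30 * T * δ by
    refine h.trans ?_
    nlinarith
  rcases lt_or_ge 1 (T * δ) with hTδ | hTδ
  · exact measureReal_le_one.trans (by nlinarith)
  set S : Fin m → Set (κ → ℝ) := fun k => {x | (y k < u k ⬝ᵥ x ∧ u k ⬝ᵥ x ≤ y k + δ) ∧
      (∀ l, u l ⬝ᵥ x - y l ≤ u k ⬝ᵥ x - y k) ∧ ∀ l < k, u l ⬝ᵥ x - y l < u k ⬝ᵥ x - y k}
  have hsub : {x | (∀ k, u k ⬝ᵥ x ≤ y k + δ) ∧ ¬ ∀ k, u k ⬝ᵥ x ≤ y k} ⊆ ⋃ k, S k := by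
    rintro x ⟨hx1, hx2⟩
    have hne : Nonempty (Fin m) := ⟨⟨0, hm⟩⟩
    obtain ⟨k0, hk0⟩ := Finite.exists_max fun k => u k ⬝ᵥ x - y k
    obtain ⟨k, hk, hmin⟩ := WellFounded.has_min (wellFounded_lt (α := Fin m))
      {k | ∀ l, u l ⬝ᵥ x - y l ≤ u k ⬝ᵥ x - y k} ⟨k0, hk0⟩
    push Not at hx2
    obtain ⟨l, hl⟩ := hx2
    refine Set.mem_iUnion.2 ⟨k, ⟨by linarith [hk l], hx1 k⟩, hk, fun l' hl' => ?_⟩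
    by_contra hcon
    exact hmin l' (fun i => (hk i).trans (not_lt.1 hcon)) hl'
  have hfar : ∀ k, ¬ y k < T → (stdGauss κ).real (S k) ≤ 4 * δ * (1 / (m + 1)) := by
    intro k hk
    refine (measureReal_mono (fun x hx => hx.1)).trans
      ((stdGauss_slab_le (u k) (hu k) hT (not_lt.1 hk) hδ (by nlinarith)).trans (le_of_eq ?_))
    rw [hT2, Real.exp_neg, mul_div_cancel_left₀ _ (by norm_num : (2 : ℝ) ≠ 0),
      Real.exp_log (by positivity), one_div]
  calc (stdGauss κ).real {x | (∀ k, u k ⬝ᵥ x ≤ y k + δ) ∧ ¬ ∀ k, u k ⬝ᵥ x ≤ y k}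
      ≤ (stdGauss κ).real (⋃ k, S k) := measureReal_mono hsub
    _ ≤ ∑ k, (stdGauss κ).real (S k) := measureReal_iUnion_fintype_le _
    _ = ∑ k with y k < T, (stdGauss κ).real (S k) + ∑ k with ¬ y k < T, (stdGauss κ).real (S k) :=
        (Finset.sum_filter_add_sum_filter_not _ _ _).symm
    _ ≤ 26 * T * δ + ∑ k with ¬ y k < T, 4 * δ * (1 / ((m : ℝ) + 1)) :=
        add_le_add (sum_stdGauss_cell_le u hu y hT hδ hTδ)
          (Finset.sum_le_sum fun k hk => hfar k (Finset.mem_filter.1 hk).2)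
    _ ≤ 26 * T * δ + ∑ k : Fin m, 4 * δ * (1 / ((m : ℝ) + 1)) := by
        gcongr
        exact Finset.subset_univ _
    _ ≤ 26 * T * δ + 4 * δ := by
        gcongr
        rw [Finset.sum_const, Finset.card_univ, Fintype.card_fin, nsmul_eq_mul]
        have : (m : ℝ) * (1 / (m + 1)) ≤ 1 := by
          rw [mul_one_div, div_le_one (by positivity)]; linarith
        nlinarith
    _ ≤ 30 * T * δ := by nlinarith

/-- **Nazarov's inequality**: anti-concentration of the Gaussian vector `A ζ` on orthants. -/
lemma stdGauss_layer_le {m : ℕ} (hm : 1 ≤ m) (A : Matrix (Fin m) κ ℝ) {b : ℝ} (hb : 0 < b)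
    (hA : ∀ k, b ≤ A k ⬝ᵥ A k) (y : Fin m → ℝ) {δ : ℝ} (hδ : 0 < δ) :
    (stdGauss κ).real {x | (∀ k, A.mulVec x k ≤ y k + δ) ∧ ¬ ∀ k, A.mulVec x k ≤ y k} ≤
      45 * √(Real.log (m + 1)) * (δ / √b) := by
  set σ : Fin m → ℝ := fun k => √(A k ⬝ᵥ A k)
  have hσb : ∀ k, √b ≤ σ k := fun k => Real.sqrt_le_sqrt (hA k)
  have hb' : 0 < √b := Real.sqrt_pos.2 hb
  have hσ : ∀ k, 0 < σ k := fun k => hb'.trans_le (hσb k)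
  have hσ2 : ∀ k, σ k * σ k = A k ⬝ᵥ A k := fun k => Real.mul_self_sqrt (hb.le.trans (hA k))
  set u : Fin m → κ → ℝ := fun k => (σ k)⁻¹ • A k
  have hu : ∀ k, u k ⬝ᵥ u k = 1 := by
    intro k
    simp only [u, dotProduct_smul, smul_dotProduct, smul_eq_mul, ← hσ2]
    field_simp [(hσ k).ne']
  refine le_trans (measureReal_mono ?_)
    (stdGauss_layer_le_of_unit hm u hu (fun k => y k / σ k) (div_pos hδ hb'))
  have hval : ∀ k x, u k ⬝ᵥ x = A.mulVec x k / σ k := by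
    intro k x
    simp only [u, smul_dotProduct, smul_eq_mul, Matrix.mulVec]
    rw [div_eq_inv_mul]
  rintro x ⟨h1, h2⟩
  refine ⟨fun k => ?_, fun h => h2 fun k => ?_⟩
  · rw [hval]
    calc A.mulVec x k / σ k ≤ (y k + δ) / σ k := by gcongr; exact h1 k
      _ = y k / σ k + δ / σ k := add_div _ _ _
      _ ≤ y k / σ k + δ / √b := by gcongr; exact hσb k
  · have := h k
    rw [hval] at this
    exact (div_le_div_iff_of_pos_right (hσ k)).1 this

end Gaussian

/-! ### Positive semidefinite matrices -/

section Matrices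

lemma transpose_eq_of_posSemidef {n : Type*} {A : Matrix n n ℝ} (hA : A.PosSemidef) : A.transpose = A := by
  have := hA.isHermitian
  rwa [Matrix.IsHermitian, Matrix.conjTranspose_eq_transpose_of_trivial] at this

variable {n : Type*} [Fintype n]

lemma posSemidef_conj {A : Matrix n n ℝ} (hA : A.PosSemidef) {B : Matrix n n ℝ}
    (hB : B.transpose = B) : (B * A * B).PosSemidef := by
  have := hA.mul_mul_conjTranspose_same B
  rwa [Matrix.conjTranspose_eq_transpose_of_trivial, hB] at this

lemma trace_mul_self_eq_sum_sq {A : Matrix n n ℝ} (hA : A.transpose = A) :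
    (A * A).trace = ∑ i, ∑ j, A i j ^ 2 := by
  simp only [Matrix.trace, Matrix.diag, Matrix.mul_apply]
  refine Finset.sum_congr rfl fun i _ => Finset.sum_congr rfl fun j _ => ?_
  rw [sq]
  congr 1
  conv_lhs => rw [← hA]
  rfl

variable [DecidableEq n]

lemma exists_symm_sqrt {A : Matrix n n ℝ} (hA : A.PosSemidef) :
    ∃ B : Matrix n n ℝ, B.transpose = B ∧ B * B = A :=
  ⟨CFC.sqrt A, by
    have := (Matrix.nonneg_iff_posSemidef.1 (CFC.sqrt_nonneg A)).isHermitian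
    rwa [Matrix.IsHermitian, Matrix.conjTranspose_eq_transpose_of_trivial] at this,
    CFC.sqrt_mul_sqrt_self A (Matrix.nonneg_iff_posSemidef.2 hA)⟩

lemma trace_mul_nonneg_of_posSemidef {A B : Matrix n n ℝ} (hA : A.PosSemidef)
    (hB : B.PosSemidef) : 0 ≤ (A * B).trace := by
  obtain ⟨C, hC, rfl⟩ := exists_symm_sqrt hA
  rw [mul_assoc, Matrix.trace_mul_comm]
  exact (posSemidef_conj hB hC).trace_nonneg

lemma abs_apply_le_sqrt_mul_sqrt {A : Matrix n n ℝ} (hA : A.PosSemidef) (i j : n) :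
    |A i j| ≤ √(A i i) * √(A j j) := by
  obtain ⟨C, hC, rfl⟩ := exists_symm_sqrt hA
  have h : ∀ i j, (C * C) i j = ∑ k, C i k * C j k := by
    intro i j
    rw [Matrix.mul_apply]
    refine Finset.sum_congr rfl fun k _ => ?_
    exact congrArg _ (congrFun (congrFun hC j) k)
  rw [← Real.sqrt_mul (h i i ▸ Finset.sum_nonneg fun k _ => mul_self_nonneg _)]
  apply Real.abs_le_sqrt
  simp only [h]
  refine (Finset.sum_mul_sq_le_sq_mul_sq _ _ _).trans (le_of_eq ?_)
  simp only [sq]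

lemma trace_mul_self_eq_sum_eigenvalues_sq {A : Matrix n n ℝ} (hA : A.IsHermitian) :
    (A * A).trace = ∑ i, hA.eigenvalues i ^ 2 := by
  have h := hA.spectral_theorem
  conv_lhs => rw [h]
  rw [← map_mul, Matrix.diagonal_mul_diagonal, Unitary.conjStarAlgAut_apply,
    Matrix.trace_mul_cycle, Unitary.coe_star_mul_self, one_mul, Matrix.trace_diagonal]
  simp [sq]

lemma sub_log_one_add_ge {x : ℝ} (hx : 0 < x) : (x - 1) ^ 2 / (2 * (x + 1)) ≤ x - 1 - Real.log x := by
  set v := √x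
  have hv : 0 < v := Real.sqrt_pos.2 hx
  have hv2 : v ^ 2 = x := Real.sq_sqrt hx.le
  have hlog : Real.log x = 2 * Real.log v := by rw [← hv2, Real.log_pow]; norm_num
  have h1 := Real.log_le_sub_one_of_pos hv
  have h2 : (x - 1) ^ 2 / (2 * (x + 1)) ≤ (v - 1) ^ 2 := by
    rw [div_le_iff₀ (by positivity), ← hv2]
    nlinarith [mul_nonneg (sq_nonneg (v - 1)) (sq_nonneg (v - 1))]
  rw [hlog]
  nlinarith

/-- Lower bound for the log-determinant divergence between `K` and `R⁻¹`. -/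
lemma logdet_divergence_ge {R K : Matrix n n ℝ} (hR : R.PosDef) (hK : K.PosDef) {ℓ q : ℝ}
    (hℓ : 0 < ℓ) (hRℓ : (R - ℓ • 1).PosSemidef) (hq0 : 0 ≤ q)
    (hq : q ^ 2 = ℓ ^ 2 * ∑ i, ∑ j, (K - R⁻¹) i j ^ 2) :
    q ^ 2 / (2 * (2 + q)) ≤
      (K * R).trace - (R⁻¹ * R).trace - Real.log K.det + Real.log (R⁻¹).det := by
  obtain ⟨B, hB, hBR⟩ := exists_symm_sqrt hR.posSemidef
  have hRu : IsUnit R.det := (Matrix.isUnit_iff_isUnit_det _).1 hR.isUnit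
  have hBdet : IsUnit B.det := by
    rw [← hBR, Matrix.det_mul] at hRu
    exact isUnit_of_mul_isUnit_left hRu
  set A := B * K * B with hAdef
  have hA0 : A.PosSemidef := posSemidef_conj hK.posSemidef hB
  have hAdet : A.det = K.det * R.det := by
    rw [hAdef, ← hBR]; simp only [Matrix.det_mul]; ring
  have hA : A.PosDef := by
    rw [hA0.posDef_iff_det_ne_zero, hAdet]
    exact mul_ne_zero hK.det_pos.ne' hR.det_pos.ne'
  set μ := hA.isHermitian.eigenvalues
  have hμ : ∀ i, 0 < μ i := hA.eigenvalues_pos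
  have hlogdet : Real.log A.det = ∑ i, Real.log (μ i) := by
    rw [hA.isHermitian.det_eq_prod_eigenvalues, ← Real.log_prod (fun i _ => (hμ i).ne')]
    rfl
  have htr : (K * R).trace = ∑ i, μ i := by
    have h1 : A.trace = ∑ i, μ i := by
      rw [hA.isHermitian.trace_eq_sum_eigenvalues]; rfl
    rw [← h1, hAdef, ← hBR, Matrix.trace_mul_cycle, Matrix.trace_mul_comm]
  set Δ := K - R⁻¹ with hΔ
  have hΔt : Δ.transpose = Δ := by
    rw [hΔ, Matrix.transpose_sub, transpose_eq_of_posSemidef hK.posSemidef,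
      transpose_eq_of_posSemidef hR.inv.posSemidef]
  have hA1 : A - 1 = B * Δ * B := by
    have : B * R⁻¹ * B = 1 := by
      rw [← hBR, Matrix.mul_inv_rev, ← mul_assoc, Matrix.mul_nonsing_inv _ hBdet, one_mul,
        Matrix.nonsing_inv_mul _ hBdet]
    rw [hΔ, mul_sub, sub_mul, this]
  have hsum : ∑ i, (μ i - 1) ^ 2 = (R * Δ * (R * Δ)).trace := by
    have h1 : ((A - 1) * (A - 1)).trace = ∑ i, (μ i - 1) ^ 2 := by
      have : ((A - 1) * (A - 1)).trace = (A * A).trace - 2 * A.trace + (1 : Matrix n n ℝ).trace := by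
        rw [sub_mul, mul_sub, mul_sub]
        simp only [Matrix.trace_sub, mul_one, one_mul]
        ring
      rw [this, trace_mul_self_eq_sum_eigenvalues_sq hA.isHermitian,
        hA.isHermitian.trace_eq_sum_eigenvalues, Matrix.trace_one]
      simp only [sub_sq, Finset.sum_add_distrib, Finset.sum_sub_distrib, mul_one, ← Finset.mul_sum]
      simp [μ]
    rw [← h1, hA1, ← hBR, show B * Δ * B * (B * Δ * B) = (B * Δ * (B * B) * Δ) * B by
      simp only [mul_assoc], Matrix.trace_mul_comm]
    simp only [mul_assoc]
  have hge : q ^ 2 ≤ ∑ i, (μ i - 1) ^ 2 := by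
    rw [hsum, hq, ← trace_mul_self_eq_sum_sq hΔt]
    set P := R - ℓ • (1 : Matrix n n ℝ) with hP
    have hRP : R = ℓ • 1 + P := by rw [hP]; abel
    have hΔP : (Δ * P * Δ).PosSemidef := posSemidef_conj hRℓ hΔt
    have h1 : 0 ≤ (Δ * P * Δ).trace := hΔP.trace_nonneg
    have h2 : 0 ≤ (P * (Δ * P * Δ)).trace := trace_mul_nonneg_of_posSemidef hRℓ hΔP
    have h3 : (P * Δ * Δ).trace = (Δ * P * Δ).trace := by
      rw [mul_assoc, Matrix.trace_mul_comm, mul_assoc, Matrix.trace_mul_comm]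
    have h4 : (R * Δ * (R * Δ)).trace = ℓ ^ 2 * (Δ * Δ).trace + 2 * ℓ * (Δ * P * Δ).trace +
        (P * (Δ * P * Δ)).trace := by
      rw [hRP]
      simp only [add_mul, mul_add, smul_mul_assoc, one_mul, mul_smul_comm, Matrix.trace_add,
        Matrix.trace_smul, smul_eq_mul]
      rw [h3]
      simp only [mul_assoc]
      ring
    rw [h4]
    nlinarith
  set F := √(∑ i, (μ i - 1) ^ 2)
  have hF2 : F ^ 2 = ∑ i, (μ i - 1) ^ 2 := Real.sq_sqrt (Finset.sum_nonneg fun i _ => sq_nonneg _)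
  have hF0 : 0 ≤ F := Real.sqrt_nonneg _
  have hqF : q ≤ F := Real.le_sqrt_of_sq_le hge
  have hμF : ∀ i, μ i - 1 ≤ F := fun i => Real.le_sqrt_of_sq_le
    (Finset.single_le_sum (f := fun i => (μ i - 1) ^ 2) (fun i _ => sq_nonneg _)
      (Finset.mem_univ i))
  have hterm : ∀ i, (μ i - 1) ^ 2 / (2 * (2 + F)) ≤ μ i - 1 - Real.log (μ i) := fun i =>
    le_trans (div_le_div_of_nonneg_left (sq_nonneg _) (by linarith [hμ i])
      (by linarith [hμF i])) (sub_log_one_add_ge (hμ i))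
  have htot := Finset.sum_le_sum fun i (_ : i ∈ Finset.univ) => hterm i
  rw [← Finset.sum_div, ← hF2] at htot
  simp only [Finset.sum_sub_distrib] at htot
  rw [← hlogdet, ← htr, hAdet, Real.log_mul hK.det_pos.ne' hR.det_pos.ne'] at htot
  rw [Matrix.nonsing_inv_mul _ hRu, Matrix.trace_one, Matrix.det_nonsing_inv,
    Ring.inverse_eq_inv', Real.log_inv]
  have hmono : q ^ 2 / (2 * (2 + q)) ≤ F ^ 2 / (2 * (2 + F)) := by
    rw [div_le_div_iff₀ (by positivity) (by positivity)]
    nlinarith [mul_nonneg (mul_nonneg hq0 hF0) (sub_nonneg.2 hqF)]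
  simp only [Finset.sum_const, Finset.card_univ, nsmul_eq_mul, mul_one] at htot
  linarith

end Matrices

lemma isClosed_posSemidef {n : Type*} [Fintype n] :
    IsClosed {A : Matrix n n ℝ | A.PosSemidef} := by
  have : {A : Matrix n n ℝ | A.PosSemidef} =
      {A | A.transpose = A} ∩ ⋂ x : n → ℝ, {A | 0 ≤ x ⬝ᵥ A.mulVec x} := by
    ext A
    simp [Matrix.posSemidef_iff_dotProduct_mulVec, Matrix.IsHermitian,
      Matrix.conjTranspose_eq_transpose_of_trivial]
  rw [this]
  exact (isClosed_eq (by fun_prop) (by fun_prop)).inter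
    (isClosed_iInter fun x => isClosed_le (by fun_prop) (by fun_prop))

/-! ### Existence of the weighted graphical Lasso estimator -/

section Existence

variable {d : ℕ}

/-- Coercivity of the penalized linear part of the objective. -/
lemma trace_add_penalty_ge {S Θ : Matrix (Fin d) (Fin d) ℝ} (hS : S.PosSemidef)
    (hΘ : Θ.PosSemidef) {lam δ : ℝ} (hδ0 : 0 ≤ δ) (hδ1 : δ ≤ 1) (hδ : δ ≤ lam) :
    δ * ∑ i, S i i * Θ i i ≤ (Θ * S).trace +
      lam * ∑ i, ∑ j, if i ≠ j then √(S i i) * √(S j j) * |Θ i j| else 0 := by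
  set pen := ∑ i, ∑ j, if i ≠ j then √(S i i) * √(S j j) * |Θ i j| else 0 with hpen
  have hpen0 : 0 ≤ pen := Finset.sum_nonneg fun i _ => Finset.sum_nonneg fun j _ => by
    split_ifs <;> positivity
  have h0 : 0 ≤ (Θ * S).trace := trace_mul_nonneg_of_posSemidef hΘ hS
  have h1 : ∑ i, S i i * Θ i i - pen ≤ (Θ * S).trace := by
    simp only [Matrix.trace, Matrix.diag, Matrix.mul_apply]
    rw [hpen, ← Finset.sum_sub_distrib]
    refine Finset.sum_le_sum fun i _ => ?_
    have : S i i * Θ i i = ∑ j, if i = j then S i i * Θ i i else 0 := by simp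
    rw [this, ← Finset.sum_sub_distrib]
    refine Finset.sum_le_sum fun j _ => ?_
    by_cases hij : i = j
    · subst hij; simp [mul_comm]
    · simp only [hij, if_false, ne_eq, not_false_eq_true, if_true, zero_sub]
      have h2 := abs_apply_le_sqrt_mul_sqrt hS j i
      have h3 : |Θ i j * S j i| ≤ √(S i i) * √(S j j) * |Θ i j| := by
        rw [abs_mul, mul_comm, mul_comm (√(S i i))]; gcongr
      linarith [neg_abs_le (Θ i j * S j i)]
  nlinarith

lemma exists_isMinimizer (hd : 0 < d) {S : Matrix (Fin d) (Fin d) ℝ} (hS : S.PosSemidef)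
    (hdiag : ∀ i, 0 < S i i) {lam : ℝ} (hlam : 0 < lam) : ∃ Θ, IsMinimizer S lam Θ := by
  have : Nonempty (Fin d) := ⟨⟨0, hd⟩⟩
  set δ := min 1 lam
  have hδ : 0 < δ := lt_min one_pos hlam
  obtain ⟨i0, hi0⟩ := Finite.exists_min fun i => S i i
  set c := δ * S i0 i0
  have hc : 0 < c := mul_pos hδ (hdiag i0)
  have hobj : ∀ Θ : Matrix (Fin d) (Fin d) ℝ, Θ.PosDef →
      c * Θ.trace - Real.log Θ.det ≤ objective S lam Θ := by
    intro Θ hΘ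
    have h1 := trace_add_penalty_ge hS hΘ.posSemidef hδ.le (min_le_left _ _) (min_le_right 1 lam)
    have h2 : c * Θ.trace ≤ δ * ∑ i, S i i * Θ i i := by
      simp only [c, mul_assoc, Matrix.trace, Matrix.diag, Finset.mul_sum]
      gcongr with i _
      · exact hΘ.diag_pos.le
      · exact hi0 i
    unfold objective
    linarith
  set e := (d : ℝ) * (-1 - Real.log (c / 2))
  have hlog : ∀ Θ : Matrix (Fin d) (Fin d) ℝ, Θ.PosDef →
      Real.log Θ.det ≤ c / 2 * Θ.trace + e := by
    intro Θ hΘ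
    have hμ := hΘ.eigenvalues_pos
    rw [hΘ.isHermitian.det_eq_prod_eigenvalues, hΘ.isHermitian.trace_eq_sum_eigenvalues]
    simp only [RCLike.ofReal_real_eq_id, id]
    rw [Real.log_prod (fun i _ => (hμ i).ne'), Finset.mul_sum]
    have : e = ∑ i : Fin d, (-1 - Real.log (c / 2)) := by
      simp only [e, Finset.sum_const, Finset.card_univ, Fintype.card_fin, nsmul_eq_mul]
    rw [this, ← Finset.sum_add_distrib]
    refine Finset.sum_le_sum fun i _ => ?_
    have h := Real.log_le_sub_one_of_pos (mul_pos (half_pos hc) (hμ i))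
    rw [Real.log_mul (half_pos hc).ne' (hμ i).ne'] at h
    linarith
  set v := objective S lam 1
  set M := 2 / c * (v + e)
  set K : Set (Matrix (Fin d) (Fin d) ℝ) :=
    {Θ | Θ.PosSemidef} ∩ ({Θ | Θ.trace ≤ M} ∩ {Θ | Real.exp (-v) ≤ Θ.det})
  have hKpd : ∀ Θ ∈ K, Θ.PosDef := fun Θ hΘ =>
    (Matrix.PosSemidef.posDef_iff_det_ne_zero hΘ.1).2 ((Real.exp_pos _).trans_le hΘ.2.2).ne'
  have hmem : ∀ Θ : Matrix (Fin d) (Fin d) ℝ, Θ.PosDef → objective S lam Θ ≤ v → Θ ∈ K := by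
    intro Θ hΘ hv
    have h1 := hobj Θ hΘ
    have h2 := hlog Θ hΘ
    have h3 : 0 ≤ Θ.trace := hΘ.posSemidef.trace_nonneg
    refine ⟨hΘ.posSemidef, ?_, ?_⟩
    · show Θ.trace ≤ 2 / c * (v + e)
      rw [div_mul_eq_mul_div, le_div_iff₀ hc]
      linarith
    · show Real.exp (-v) ≤ Θ.det
      rw [← Real.le_log_iff_exp_le hΘ.det_pos]
      nlinarith
  have hKc : IsCompact K := by
    refine IsCompact.of_isClosed_subset
      (isCompact_univ_pi fun _ : Fin d => isCompact_univ_pi fun _ : Fin d =>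
        isCompact_Icc (a := -M) (b := M)) ?_ ?_
    · exact isClosed_posSemidef.inter ((isClosed_le (by fun_prop) (by fun_prop)).inter
        (isClosed_le (by fun_prop) (by fun_prop)))
    · intro Θ hΘ i _ j _
      rw [Set.mem_Icc, ← abs_le]
      have hle : ∀ i, Θ i i ≤ M := fun i => le_trans
        (Finset.single_le_sum (f := fun i => Θ i i) (fun i _ => hΘ.1.diag_nonneg)
          (Finset.mem_univ i)) hΘ.2.1
      have hM : 0 ≤ M := hΘ.1.diag_nonneg.trans (hle i)
      calc |Θ i j| ≤ √(Θ i i) * √(Θ j j) := abs_apply_le_sqrt_mul_sqrt hΘ.1 i j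
        _ ≤ √M * √M := by gcongr <;> exact hle _
        _ = M := Real.mul_self_sqrt hM
  have hcont : ContinuousOn (objective S lam) K := by
    unfold objective
    refine (ContinuousOn.sub (by fun_prop) (ContinuousOn.log (by fun_prop) fun Θ hΘ =>
      (hKpd Θ hΘ).det_pos.ne')).add (Continuous.continuousOn ?_)
    refine continuous_const.mul (continuous_finsetSum _ fun i _ => continuous_finsetSum _
      fun j _ => ?_)
    split_ifs
    · exact continuous_const.mul (continuous_id.matrix_elem i j).abs
    · exact continuous_const
  obtain ⟨Θ, hΘK, hΘ⟩ := hKc.exists_isMinOn ⟨1, hmem 1 Matrix.PosDef.one le_rfl⟩ hcont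
  refine ⟨Θ, hKpd Θ hΘK, fun Θ' hΘ' => ?_⟩
  by_cases h : objective S lam Θ' ≤ v
  · exact hΘ (hmem Θ' hΘ' h)
  · exact (hΘ (hmem 1 Matrix.PosDef.one le_rfl)).trans (not_le.1 h).le

lemma estimator_isMinimizer (hd : 0 < d) {S : Matrix (Fin d) (Fin d) ℝ} (hS : S.PosSemidef)
    (hdiag : ∀ i, 0 < S i i) {lam : ℝ} (hlam : 0 < lam) :
    IsMinimizer S lam (estimator S lam) := by
  have h := exists_isMinimizer hd hS hdiag hlam
  rw [estimator, dif_pos h]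
  exact h.choose_spec

end Existence

/-! ### Oracle inequality for the graphical Lasso in correlation coordinates -/

section Oracle

variable {d : ℕ}

/-- The off-diagonal `ℓ₁` norm. -/
def offSum (A : Matrix (Fin d) (Fin d) ℝ) : ℝ := ∑ i, ∑ j, if i ≠ j then |A i j| else 0

/-- The sum of the squares of the entries. -/
def frobSq (A : Matrix (Fin d) (Fin d) ℝ) : ℝ := ∑ i, ∑ j, A i j ^ 2

lemma frobSq_nonneg (A : Matrix (Fin d) (Fin d) ℝ) : 0 ≤ frobSq A :=
  Finset.sum_nonneg fun _ _ => Finset.sum_nonneg fun _ _ => sq_nonneg _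

lemma offSum_nonneg (A : Matrix (Fin d) (Fin d) ℝ) : 0 ≤ offSum A :=
  Finset.sum_nonneg fun _ _ => Finset.sum_nonneg fun _ _ => by split_ifs <;> positivity

open Classical in
lemma sum_support_abs_le (A B : Matrix (Fin d) (Fin d) ℝ) {s₀ : ℝ} (hs : (sparsity A : ℝ) ≤ s₀) :
    (∑ i, ∑ j, if A i j ≠ 0 ∧ i ≠ j then |B i j| else 0) ≤ √s₀ * √(frobSq B) := by
  have h1 : (∑ i, ∑ j, if A i j ≠ 0 ∧ i ≠ j then |B i j| else 0) =
      ∑ p : Fin d × Fin d with A p.1 p.2 ≠ 0 ∧ p.1 ≠ p.2, |B p.1 p.2| := by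
    rw [Finset.sum_filter, Fintype.sum_prod_type]
  have h2 : frobSq B = ∑ p : Fin d × Fin d, B p.1 p.2 ^ 2 := by
    rw [Fintype.sum_prod_type, frobSq]
  rw [h1, ← Real.sqrt_mul' _ (frobSq_nonneg B)]
  refine Real.le_sqrt_of_sq_le (sq_sum_le_card_mul_sum_sq.trans ?_)
  rw [h2]
  simp only [sq_abs]
  refine mul_le_mul hs ?_ (Finset.sum_nonneg fun _ _ => sq_nonneg _) ((Nat.cast_nonneg _).trans hs)
  exact Finset.sum_le_sum_of_subset_of_nonneg (Finset.filter_subset _ _) fun _ _ _ => sq_nonneg _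

/-- Oracle inequality for near-minimizers of the graphical Lasso objective with a correlation
matrix estimate `Rh` of `R`. -/
lemma graphicalLasso_oracle {R Rh K : Matrix (Fin d) (Fin d) ℝ} (hR : R.PosDef) (hK : K.PosDef)
    {ℓ lam s₀ : ℝ} (hℓ : 0 < ℓ) (hRℓ : (R - ℓ • 1).PosSemidef) (hlam : 0 < lam)
    (hs : (sparsity R⁻¹ : ℝ) ≤ s₀) (hdiag : ∀ i, Rh i i = R i i)
    (hoff : ∀ i j, |Rh i j - R i j| ≤ lam / 2) (hcond : 8 * lam * √s₀ ≤ ℓ)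
    (hmin : (K * Rh).trace - Real.log K.det + lam * offSum K ≤
      (R⁻¹ * Rh).trace - Real.log (R⁻¹).det + lam * offSum R⁻¹) :
    √(frobSq (K - R⁻¹)) ≤ 16 * lam * √s₀ / ℓ ^ 2 ∧
      offSum (K - R⁻¹) ≤ 64 * lam * s₀ / ℓ ^ 2 := by
  classical
  set Δ := K - R⁻¹ with hΔ
  set F := √(frobSq Δ)
  have hF0 : 0 ≤ F := Real.sqrt_nonneg _
  have hF2 : F ^ 2 = frobSq Δ := Real.sq_sqrt (frobSq_nonneg Δ)
  have hs0 : 0 ≤ s₀ := (Nat.cast_nonneg _).trans hs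
  have hdiv := logdet_divergence_ge hR hK hℓ hRℓ (q := ℓ * F) (by positivity)
    (by rw [mul_pow, hF2, frobSq])
  set D := ∑ i, ∑ j, if R⁻¹ i j ≠ 0 ∧ i ≠ j then |Δ i j| else 0
  have hD : D ≤ √s₀ * F := sum_support_abs_le _ _ hs
  have hlin : lam / 2 * offSum Δ - 2 * lam * D ≤
      ((K * Rh).trace - (R⁻¹ * Rh).trace - (K * R).trace + (R⁻¹ * R).trace) +
        lam * (offSum K - offSum R⁻¹) := by
    have h1 : (K * Rh).trace - (R⁻¹ * Rh).trace - (K * R).trace + (R⁻¹ * R).trace =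
        ∑ i, ∑ j, Δ i j * (Rh j i - R j i) := by
      have : (K * Rh).trace - (R⁻¹ * Rh).trace - (K * R).trace + (R⁻¹ * R).trace =
          (Δ * (Rh - R)).trace := by
        rw [hΔ, sub_mul, mul_sub, mul_sub]
        simp only [Matrix.trace_sub]
        ring
      rw [this]
      simp only [Matrix.trace, Matrix.diag, Matrix.mul_apply, Matrix.sub_apply]
    rw [h1]
    simp only [offSum, D, ← Finset.sum_sub_distrib, Finset.mul_sum, ← Finset.sum_add_distrib]
    refine Finset.sum_le_sum fun i _ => Finset.sum_le_sum fun j _ => ?_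
    by_cases hij : i = j
    · subst hij; simp [hdiag]
    · have h2 : -(lam / 2 * |Δ i j|) ≤ Δ i j * (Rh j i - R j i) := by
        have h3 : |Δ i j * (Rh j i - R j i)| ≤ lam / 2 * |Δ i j| := by
          rw [abs_mul, mul_comm]; gcongr; exact hoff j i
        linarith [neg_abs_le (Δ i j * (Rh j i - R j i))]
      have hKΔ : K i j = R⁻¹ i j + Δ i j := by simp [hΔ]
      simp only [ne_eq, hij, not_false_eq_true, if_true, and_true]
      by_cases h0 : R⁻¹ i j = 0
      · simp only [h0, hKΔ, not_true_eq_false, if_false, zero_add, abs_zero]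
        linarith
      · simp only [h0, not_false_eq_true, if_true]
        have h4 : -|Δ i j| ≤ |K i j| - |R⁻¹ i j| := by
          have := abs_sub_abs_le_abs_sub (R⁻¹ i j) (K i j)
          rw [hKΔ] at this ⊢
          rw [show R⁻¹ i j - (R⁻¹ i j + Δ i j) = -Δ i j by ring, abs_neg] at this
          linarith
        nlinarith
  have hoff0 := offSum_nonneg Δ
  set q := ℓ * F
  have hq0 : 0 ≤ q := by positivity
  have hmain : q ^ 2 / (2 * (2 + q)) + lam / 2 * offSum Δ ≤ 2 * lam * (√s₀ * F) := by
    have : 2 * lam * D ≤ 2 * lam * (√s₀ * F) := by gcongr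
    linarith
  have hFb : F ≤ 16 * lam * √s₀ / ℓ ^ 2 := by
    have h5 : q ^ 2 / (2 * (2 + q)) ≤ 2 * lam * (√s₀ * F) := by
      have : 0 ≤ lam / 2 * offSum Δ := by positivity
      linarith
    rw [div_le_iff₀ (by positivity)] at h5
    rcases hF0.eq_or_lt with h | h
    · rw [← h]; positivity
    · rw [le_div_iff₀ (by positivity)]
      have h6 : ℓ ^ 2 * F ≤ 4 * lam * √s₀ * (2 + q) := by
        have : F * (ℓ ^ 2 * F) ≤ F * (4 * lam * √s₀ * (2 + q)) := by
          simp only [q] at h5 ⊢; nlinarith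
        exact le_of_mul_le_mul_left this h
      have h7 : 4 * lam * √s₀ * q ≤ ℓ / 2 * q := by gcongr; linarith
      simp only [q] at h6 h7
      nlinarith
  refine ⟨hFb, ?_⟩
  have h8 : 0 ≤ q ^ 2 / (2 * (2 + q)) := by positivity
  have h9 : lam * offSum Δ ≤ lam * (4 * (√s₀ * F)) := by linarith
  calc offSum Δ ≤ 4 * (√s₀ * F) := le_of_mul_le_mul_left h9 hlam
    _ ≤ 4 * (√s₀ * (16 * lam * √s₀ / ℓ ^ 2)) := by gcongr
    _ = 64 * lam * (√s₀ * √s₀) / ℓ ^ 2 := by ring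
    _ = 64 * lam * s₀ / ℓ ^ 2 := by rw [Real.mul_self_sqrt hs0]

lemma diagonal_conj_apply (a b : Fin d → ℝ) (K : Matrix (Fin d) (Fin d) ℝ) (i j : Fin d) :
    (Matrix.diagonal a * K * Matrix.diagonal b) i j = a i * K i j * b j := by
  rw [Matrix.mul_diagonal, Matrix.diagonal_mul]

lemma diagonal_inv_mul_diagonal {w : Fin d → ℝ} (hw : ∀ i, w i ≠ 0) :
    Matrix.diagonal w⁻¹ * Matrix.diagonal w = 1 := by
  rw [Matrix.diagonal_mul_diagonal, ← Matrix.diagonal_one]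
  congr 1; ext i; simp [hw i]

lemma diagonal_mul_diagonal_inv {w : Fin d → ℝ} (hw : ∀ i, w i ≠ 0) :
    Matrix.diagonal w * Matrix.diagonal w⁻¹ = 1 := by
  rw [Matrix.diagonal_mul_diagonal, ← Matrix.diagonal_one]
  congr 1; ext i; simp [hw i]

lemma posDef_diagonal_conj {w : Fin d → ℝ} (hw : ∀ i, w i ≠ 0) {K : Matrix (Fin d) (Fin d) ℝ}
    (hK : K.PosDef) : (Matrix.diagonal w * K * Matrix.diagonal w).PosDef := by
  rw [(posSemidef_conj hK.posSemidef (Matrix.diagonal_transpose w)).posDef_iff_det_ne_zero,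
    Matrix.det_mul, Matrix.det_mul, Matrix.det_diagonal]
  have := Finset.prod_ne_zero_iff.2 fun i (_ : i ∈ Finset.univ) => hw i
  exact mul_ne_zero (mul_ne_zero this hK.det_pos.ne') this

/-- The weighted objective in correlation coordinates. -/
lemma objective_diagonal_conj {S K : Matrix (Fin d) (Fin d) ℝ} (lam : ℝ) (hK : K.PosDef)
    {w : Fin d → ℝ} (hwS : ∀ i, w i = √(S i i)) (hw : ∀ i, 0 < w i) :
    objective S lam (Matrix.diagonal w⁻¹ * K * Matrix.diagonal w⁻¹) =
      (K * (Matrix.diagonal w⁻¹ * S * Matrix.diagonal w⁻¹)).trace - Real.log K.det +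
        lam * offSum K - Real.log ((∏ i, (w i)⁻¹) ^ 2) := by
  have h1 : (Matrix.diagonal w⁻¹ * K * Matrix.diagonal w⁻¹ * S).trace =
      (K * (Matrix.diagonal w⁻¹ * S * Matrix.diagonal w⁻¹)).trace := by
    rw [show Matrix.diagonal w⁻¹ * K * Matrix.diagonal w⁻¹ * S =
      Matrix.diagonal w⁻¹ * (K * Matrix.diagonal w⁻¹ * S) by simp only [mul_assoc],
      Matrix.trace_mul_comm]
    simp only [mul_assoc]
  have hp : 0 < ∏ i, (w i)⁻¹ := Finset.prod_pos fun i _ => inv_pos.2 (hw i)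
  have h2 : Real.log (Matrix.diagonal w⁻¹ * K * Matrix.diagonal w⁻¹).det =
      Real.log K.det + Real.log ((∏ i, (w i)⁻¹) ^ 2) := by
    rw [← Real.log_mul hK.det_pos.ne' (by positivity)]
    congr 1
    simp only [Matrix.det_mul, Matrix.det_diagonal, Pi.inv_apply]
    ring
  have h3 : (∑ i, ∑ j, if i ≠ j then √(S i i) * √(S j j) *
      |(Matrix.diagonal w⁻¹ * K * Matrix.diagonal w⁻¹) i j| else 0) = offSum K := by
    refine Finset.sum_congr rfl fun i _ => Finset.sum_congr rfl fun j _ => ?_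
    split_ifs
    · rw [diagonal_conj_apply, ← hwS, ← hwS, abs_mul, abs_mul, Pi.inv_apply, Pi.inv_apply,
        abs_of_pos (inv_pos.2 (hw i)), abs_of_pos (inv_pos.2 (hw j))]
      have := (hw i).ne'
      have := (hw j).ne'
      field_simp
    · rfl
  rw [objective, h1, h2, h3]
  ring

end Oracle

/-! ### Rates for the precision matrix estimator -/

section Precision

variable {d : ℕ}

lemma smul_one_le_apply {A : Matrix (Fin d) (Fin d) ℝ} {c : ℝ} (h : (A - c • 1).PosSemidef)
    (i : Fin d) : c ≤ A i i := by
  have := h.diag_nonneg (i := i)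
  simpa using this

lemma apply_le_of_le_smul_one {A : Matrix (Fin d) (Fin d) ℝ} {c : ℝ}
    (h : (c • 1 - A).PosSemidef) (i : Fin d) : A i i ≤ c := by
  have := h.diag_nonneg (i := i)
  simpa using this

lemma inv_row_sq_le {A : Matrix (Fin d) (Fin d) ℝ} (hA : A.PosDef) {M : ℝ} (hM : 0 < M)
    (h : (A - M⁻¹ • 1).PosSemidef) (i : Fin d) : ∑ j, A⁻¹ i j ^ 2 ≤ M ^ 2 := by
  set y : Fin d → ℝ := fun j => A⁻¹ i j
  have hAt := transpose_eq_of_posSemidef hA.posSemidef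
  have hy : A.mulVec y = Pi.single i 1 := by
    have h1 : y = A⁻¹.mulVec (Pi.single i 1) := by
      ext j
      rw [Matrix.mulVec_single_one]
      exact (congrFun (congrFun (transpose_eq_of_posSemidef hA.inv.posSemidef) j) i)
    rw [h1, Matrix.mulVec_mulVec, Matrix.mul_nonsing_inv _ ((Matrix.isUnit_iff_isUnit_det _).1 hA.isUnit),
      Matrix.one_mulVec]
  have h2 : 0 ≤ y ⬝ᵥ (A - M⁻¹ • 1).mulVec y := by simpa using h.dotProduct_mulVec_nonneg y
  rw [Matrix.sub_mulVec, hy, Matrix.smul_mulVec, Matrix.one_mulVec, dotProduct_sub,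
    dotProduct_single_one, dotProduct_smul, smul_eq_mul] at h2
  have h3 : y ⬝ᵥ y = ∑ j, A⁻¹ i j ^ 2 := by simp only [dotProduct, y, sq]
  have h4 : y i ^ 2 ≤ ∑ j, A⁻¹ i j ^ 2 :=
    Finset.single_le_sum (f := fun j => A⁻¹ i j ^ 2) (fun j _ => sq_nonneg _) (Finset.mem_univ i)
  rw [h3] at h2
  set N := ∑ j, A⁻¹ i j ^ 2
  have hN : 0 ≤ N := (sq_nonneg _).trans h4
  have h5 : N ≤ M * y i := by
    have h6 : M * (M⁻¹ * N) ≤ M * y i := mul_le_mul_of_nonneg_left (by linarith) hM.le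
    rwa [← mul_assoc, mul_inv_cancel₀ hM.ne', one_mul] at h6
  rcases hN.eq_or_lt with h6 | h6
  · rw [← h6]; positivity
  · have h7 : N * N ≤ M ^ 2 * N := by
      calc N * N ≤ (M * y i) * (M * y i) := mul_le_mul h5 h5 hN (hN.trans h5)
        _ = M ^ 2 * y i ^ 2 := by ring
        _ ≤ M ^ 2 * N := by gcongr
    exact le_of_mul_le_mul_right h7 h6

lemma quad_le_of_le_smul_one {A : Matrix (Fin d) (Fin d) ℝ} (hA : A.PosSemidef) {M : ℝ}
    (hM : 0 ≤ M) (h : (M • 1 - A).PosSemidef) (x y : Fin d → ℝ) {c : ℝ}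
    (hx : x ⬝ᵥ x ≤ c) (hy : y ⬝ᵥ y ≤ c) : |x ⬝ᵥ A.mulVec y| ≤ M * c := by
  have key : ∀ z : Fin d → ℝ, z ⬝ᵥ z ≤ c → z ⬝ᵥ A.mulVec z ≤ M * c := by
    intro z hz
    have h2 : 0 ≤ z ⬝ᵥ (M • 1 - A).mulVec z := by simpa using h.dotProduct_mulVec_nonneg z
    rw [Matrix.sub_mulVec, Matrix.smul_mulVec, Matrix.one_mulVec, dotProduct_sub,
      dotProduct_smul, smul_eq_mul] at h2
    nlinarith
  have hsymm : y ⬝ᵥ A.mulVec x = x ⬝ᵥ A.mulVec y := by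
    rw [Matrix.dotProduct_mulVec, ← Matrix.mulVec_transpose,
      transpose_eq_of_posSemidef hA, dotProduct_comm]
  have h1 : 0 ≤ (x + y) ⬝ᵥ A.mulVec (x + y) := by
    simpa using hA.dotProduct_mulVec_nonneg (x + y)
  have h2 : 0 ≤ (x - y) ⬝ᵥ A.mulVec (x - y) := by
    simpa using hA.dotProduct_mulVec_nonneg (x - y)
  rw [Matrix.mulVec_add, dotProduct_add, add_dotProduct, add_dotProduct, hsymm] at h1
  rw [Matrix.mulVec_sub, dotProduct_sub, sub_dotProduct, sub_dotProduct, hsymm] at h2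
  have h3 := key x hx
  have h4 := key y hy
  rw [abs_le]
  constructor <;> linarith

open Classical in
lemma sum_abs_row_le (A : Matrix (Fin d) (Fin d) ℝ) (hA : A.transpose = A) {M g : ℝ} (hM : 0 ≤ M)
    (hg : 1 ≤ g) (hdeg : (maxDegree A : ℝ) ≤ g) (i : Fin d) (hrow : ∑ j, A i j ^ 2 ≤ M ^ 2) :
    ∑ j, |A i j| ≤ 2 * M * √g := by
  have hsym : ∀ j, A j i = A i j := fun j => congrFun (congrFun hA i) j
  set T := Finset.univ.filter fun j : Fin d => A i j ≠ 0
  have h1 : ∑ j, |A i j| = ∑ j ∈ T, |A i j| := by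
    rw [Finset.sum_filter]
    refine Finset.sum_congr rfl fun j _ => ?_
    split_ifs with h
    · rfl
    · simp [not_not.1 h]
  have hT : (T.card : ℝ) ≤ 2 * g := by
    have h2 : T ⊆ insert i (Finset.univ.filter fun j : Fin d => A j i ≠ 0 ∧ j ≠ i) := by
      intro j hj
      by_cases hji : j = i
      · simp [hji]
      · simp only [T, Finset.mem_filter, Finset.mem_univ, true_and] at hj
        simp [hji, hsym, hj]
    have h3 := (Finset.card_le_card h2).trans (Finset.card_insert_le _ _)
    have h4 : (Finset.univ.filter fun j : Fin d => A j i ≠ 0 ∧ j ≠ i).card ≤ maxDegree A :=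
      Finset.le_sup (f := fun j : Fin d =>
        (Finset.univ.filter fun i : Fin d => A i j ≠ 0 ∧ i ≠ j).card) (Finset.mem_univ i)
    have h5 : (T.card : ℝ) ≤ maxDegree A + 1 := by exact_mod_cast h3.trans (by omega)
    linarith
  rw [h1]
  have h6 : (∑ j ∈ T, |A i j|) ^ 2 ≤ (2 * M * √g) ^ 2 := by
    refine sq_sum_le_card_mul_sum_sq.trans ?_
    simp only [sq_abs]
    rw [mul_pow, Real.sq_sqrt (by linarith)]
    have h7 : ∑ j ∈ T, A i j ^ 2 ≤ M ^ 2 := le_trans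
      (Finset.sum_le_sum_of_subset_of_nonneg (Finset.subset_univ _) fun _ _ _ => sq_nonneg _) hrow
    calc (T.card : ℝ) * ∑ j ∈ T, A i j ^ 2 ≤ (2 * g) * M ^ 2 :=
          mul_le_mul hT h7 (Finset.sum_nonneg fun _ _ => sq_nonneg _) (by linarith)
      _ ≤ (2 * M) ^ 2 * g := by nlinarith [sq_nonneg M, mul_nonneg (sq_nonneg M) (by linarith : 0 ≤ g)]
  exact le_of_sq_le_sq h6 (by positivity)

open Classical in
lemma maxDegree_le_sparsity (A : Matrix (Fin d) (Fin d) ℝ) : maxDegree A ≤ sparsity A := by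
  refine Finset.sup_le fun j _ => ?_
  refine Finset.card_le_card_of_injOn (fun i => (i, j)) ?_ ?_
  · intro i hi
    simpa using hi
  · intro a _ b _ hab
    exact congrArg Prod.fst hab

open Classical in
lemma sparsity_congr {A B : Matrix (Fin d) (Fin d) ℝ} (h : ∀ i j, A i j ≠ 0 ↔ B i j ≠ 0) :
    sparsity A = sparsity B := by
  unfold sparsity
  congr 1
  ext p
  simp only [Finset.mem_filter, h]

lemma sqrt_ratio_sub_one_le {a b M e : ℝ} (hM : 0 < M) (hb : (2 * M)⁻¹ ≤ b) (ha : 0 ≤ a)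
    (hab : |b - a| ≤ e) : |√a / √b - 1| ≤ 2 * M * e := by
  have hb0 : 0 < b := lt_of_lt_of_le (by positivity) hb
  have hw : 0 < √b := Real.sqrt_pos.2 hb0
  have he : 0 ≤ e := (abs_nonneg _).trans hab
  have h1 : |√a / √b - 1| * b ≤ e := by
    have h2 : b = √b * √b := (Real.mul_self_sqrt hb0.le).symm
    have h3 : a = √a * √a := (Real.mul_self_sqrt ha).symm
    have h4 : |√a / √b - 1| * √b = |√a - √b| := by
      rw [← abs_of_pos hw, ← abs_mul, abs_of_pos hw, sub_mul, one_mul, div_mul_cancel₀ _ hw.ne']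
    have h5 : |√a - √b| * (√a + √b) = |b - a| := by
      have h6 : b - a = -((√a - √b) * (√a + √b)) := by linear_combination h2 - h3
      rw [h6, abs_neg, abs_mul, abs_of_pos (a := √a + √b) (by positivity)]
    calc |√a / √b - 1| * b = |√a - √b| * √b := by
          rw [← h4, mul_assoc, ← h2]
      _ ≤ |√a - √b| * (√a + √b) := by gcongr; linarith [Real.sqrt_nonneg a]
      _ ≤ e := h5.le.trans hab
  have h6 : |√a / √b - 1| * (2 * M)⁻¹ ≤ e := le_trans (by gcongr) h1
  rw [← div_eq_mul_inv, div_le_iff₀ (by positivity)] at h6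
  linarith

/-- Row-wise rates of convergence of the weighted graphical Lasso. -/
lemma minimizer_rates {Sig S Θ : Matrix (Fin d) (Fin d) ℝ} (hSig : Sig.PosDef) {M lam s₀ : ℝ}
    (hM : 1 ≤ M) (hlow : (Sig - M⁻¹ • 1).PosSemidef) (hlam : 0 < lam) (hs₀ : 1 ≤ s₀)
    (hs : (sparsity Sig⁻¹ : ℝ) ≤ s₀)
    (hE : ∀ i j, |S i j - Sig i j| ≤ lam / (16 * M)) (hcond : lam * s₀ ≤ 1 / (8 * M ^ 2))
    (hup : (M • 1 - Sig).PosSemidef) (hΘ : IsMinimizer S lam Θ) (i : Fin d) :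
    ∑ j, (Θ - Sig⁻¹) i j ^ 2 ≤ 2050 * M ^ 10 * (lam ^ 2 * s₀) ∧
      ∑ j, |(Θ - Sig⁻¹) i j| ≤ 162 * M ^ 5 * (lam * s₀) := by
  have hM0 : 0 < M := by linarith
  have hlam1 : lam ≤ 1 / 8 := by
    calc lam ≤ lam * s₀ := by nlinarith
      _ ≤ 1 / (8 * M ^ 2) := hcond
      _ ≤ 1 / 8 := by apply one_div_le_one_div_of_le (by norm_num); nlinarith
  set e := lam / (16 * M) with he
  have he0 : 0 < e := by positivity
  have heM : 2 * M * e = lam / 8 := by rw [he]; field_simp; norm_num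
  have hSigd : ∀ i, M⁻¹ ≤ Sig i i := smul_one_le_apply hlow
  have hSigu : ∀ i, Sig i i ≤ M := apply_le_of_le_smul_one hup
  have hSigpos : ∀ i, 0 < Sig i i := fun i => hSig.diag_pos
  have hSd : ∀ i, (2 * M)⁻¹ ≤ S i i := by
    intro i
    have h1 := (abs_le.1 (hE i i)).1
    have h2 := hSigd i
    have h3 : e ≤ (2 * M)⁻¹ := by
      rw [← one_div, le_div_iff₀ (by positivity)]
      linarith
    have h4 : M⁻¹ = 2 * (2 * M)⁻¹ := by field_simp
    linarith
  set w : Fin d → ℝ := fun i => √(S i i)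
  set v : Fin d → ℝ := fun i => √(Sig i i)
  have hSpos : ∀ i, 0 < S i i := fun i => lt_of_lt_of_le (by positivity) (hSd i)
  have hw : ∀ i, 0 < w i := fun i => Real.sqrt_pos.2 (hSpos i)
  have hv : ∀ i, 0 < v i := fun i => Real.sqrt_pos.2 (hSigpos i)
  have hw2 : ∀ i, w i * w i = S i i := fun i => Real.mul_self_sqrt (hSpos i).le
  have hv2 : ∀ i, v i * v i = Sig i i := fun i => Real.mul_self_sqrt (hSigpos i).le
  have hw0 : ∀ i, w i ≠ 0 := fun i => (hw i).ne'
  have hv0 : ∀ i, v i ≠ 0 := fun i => (hv i).ne'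
  have hwi : ∀ i j, (w i)⁻¹ * (w j)⁻¹ ≤ 2 * M := by
    intro i j
    have h1 : ∀ i, (w i)⁻¹ ≤ √(2 * M) := by
      intro i
      rw [inv_le_comm₀ (hw i) (by positivity), ← Real.sqrt_inv]
      exact Real.sqrt_le_sqrt (hSd i)
    calc _ ≤ √(2 * M) * √(2 * M) := mul_le_mul (h1 i) (h1 j) (inv_pos.2 (hw j)).le (by positivity)
      _ = 2 * M := Real.mul_self_sqrt (by positivity)
  set r : Fin d → ℝ := fun i => v i / w i
  have hr : ∀ i, |r i - 1| ≤ lam / 8 := fun i =>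
    (sqrt_ratio_sub_one_le hM0 (hSd i) (hSigpos i).le (hE i i)).trans heM.le
  have hrr : ∀ i j, |r i * r j - 1| ≤ 3 / 8 * lam := by
    intro i j
    have h1 : r i * r j - 1 = (r i - 1) * (r j - 1) + (r i - 1) + (r j - 1) := by ring
    rw [h1]
    have h2 : |(r i - 1) * (r j - 1)| ≤ lam / 8 := by
      rw [abs_mul]
      have := mul_le_mul (hr i) (hr j) (abs_nonneg _) (by positivity)
      nlinarith
    calc _ ≤ |(r i - 1) * (r j - 1)| + |r i - 1| + |r j - 1| := abs_add_three _ _ _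
      _ ≤ _ := by linarith [hr i, hr j]
  -- correlation coordinates
  set R := Matrix.diagonal v⁻¹ * Sig * Matrix.diagonal v⁻¹ with hRdef
  set Rh := Matrix.diagonal w⁻¹ * S * Matrix.diagonal w⁻¹ with hRhdef
  set K := Matrix.diagonal w * Θ * Matrix.diagonal w with hKdef
  have hRpd : R.PosDef := posDef_diagonal_conj (fun i => by simp [hv0 i]) hSig
  have hKpd : K.PosDef := posDef_diagonal_conj hw0 hΘ.1
  have hSigu' : IsUnit Sig.det := (Matrix.isUnit_iff_isUnit_det _).1 hSig.isUnit
  have hRinv : R⁻¹ = Matrix.diagonal v * Sig⁻¹ * Matrix.diagonal v := by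
    apply Matrix.inv_eq_right_inv
    calc R * (Matrix.diagonal v * Sig⁻¹ * Matrix.diagonal v)
        = Matrix.diagonal v⁻¹ * (Sig * (Matrix.diagonal v⁻¹ * Matrix.diagonal v) * Sig⁻¹) *
            Matrix.diagonal v := by simp only [hRdef, mul_assoc]
      _ = 1 := by
        rw [diagonal_inv_mul_diagonal hv0, mul_one, Matrix.mul_nonsing_inv _ hSigu', mul_one,
          diagonal_inv_mul_diagonal hv0]
  have hRℓ : (R - (M ^ 2)⁻¹ • 1).PosSemidef := by
    have h1 := posSemidef_conj hlow (Matrix.diagonal_transpose v⁻¹)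
    have h2 : (Matrix.diagonal fun i => (v i)⁻¹ * M⁻¹ * (v i)⁻¹ - (M ^ 2)⁻¹ :
        Matrix (Fin d) (Fin d) ℝ).PosSemidef := by
      refine Matrix.PosSemidef.diagonal fun i => ?_
      show 0 ≤ (v i)⁻¹ * M⁻¹ * (v i)⁻¹ - (M ^ 2)⁻¹
      have h3 : (v i)⁻¹ * M⁻¹ * (v i)⁻¹ = (Sig i i * M)⁻¹ := by
        rw [← hv2, mul_inv, mul_inv]; ring
      rw [h3, sub_nonneg]
      apply inv_anti₀ (mul_pos (hSigpos i) hM0)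
      nlinarith [hSigu i]
    have h4 : R - (M ^ 2)⁻¹ • 1 = Matrix.diagonal v⁻¹ * (Sig - M⁻¹ • 1) * Matrix.diagonal v⁻¹ +
        Matrix.diagonal fun i => (v i)⁻¹ * M⁻¹ * (v i)⁻¹ - (M ^ 2)⁻¹ := by
      ext a b
      rw [Matrix.add_apply, diagonal_conj_apply, Matrix.sub_apply, Matrix.sub_apply,
        hRdef, diagonal_conj_apply]
      by_cases hab : a = b
      · subst hab; simp; ring
      · simp [hab]
    rw [h4]
    exact h1.add h2
  have hsR : (sparsity R⁻¹ : ℝ) ≤ s₀ := by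
    rw [sparsity_congr (B := Sig⁻¹)]
    · exact hs
    · intro a b
      rw [hRinv, diagonal_conj_apply]
      simp [hv0]
  have hRdiag : ∀ i, Rh i i = R i i := by
    intro i
    rw [hRhdef, hRdef, diagonal_conj_apply, diagonal_conj_apply, ← hw2, ← hv2]
    simp [hw0, hv0]
  have hRE : ∀ i j, |Rh i j - R i j| ≤ lam / 2 := by
    intro i j
    have h1 : Rh i j - R i j = (w i)⁻¹ * (w j)⁻¹ * (S i j - Sig i j) +
        ((v i)⁻¹ * (v j)⁻¹ * Sig i j) * (r i * r j - 1) := by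
      rw [hRhdef, hRdef, diagonal_conj_apply, diagonal_conj_apply]
      simp only [Pi.inv_apply, r]
      have := hw0 i; have := hw0 j; have := hv0 i; have := hv0 j
      field_simp
      ring
    have h2 : |(v i)⁻¹ * (v j)⁻¹ * Sig i j| ≤ 1 := by
      rw [abs_mul, abs_of_pos (mul_pos (inv_pos.2 (hv i)) (inv_pos.2 (hv j)))]
      calc _ ≤ (v i)⁻¹ * (v j)⁻¹ * (v i * v j) := by
            have := mul_pos (inv_pos.2 (hv i)) (inv_pos.2 (hv j))
            gcongr
            exact abs_apply_le_sqrt_mul_sqrt hSig.posSemidef i j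
        _ = 1 := by
            have := hv0 i; have := hv0 j
            field_simp
    have h3 : |(w i)⁻¹ * (w j)⁻¹ * (S i j - Sig i j)| ≤ lam / 8 := by
      rw [abs_mul, abs_of_pos (mul_pos (inv_pos.2 (hw i)) (inv_pos.2 (hw j))), ← heM]
      exact mul_le_mul (hwi i j) (hE i j) (abs_nonneg _) (by positivity)
    have h4 : |((v i)⁻¹ * (v j)⁻¹ * Sig i j) * (r i * r j - 1)| ≤ 3 / 8 * lam := by
      rw [abs_mul]
      calc _ ≤ 1 * (3 / 8 * lam) := mul_le_mul h2 (hrr i j) (abs_nonneg _) zero_le_one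
        _ = _ := one_mul _
    rw [h1]
    calc _ ≤ _ := abs_add_le _ _
      _ ≤ lam / 2 := by linarith
  have hmin : (K * Rh).trace - Real.log K.det + lam * offSum K ≤
      (R⁻¹ * Rh).trace - Real.log (R⁻¹).det + lam * offSum R⁻¹ := by
    have h1 := objective_diagonal_conj lam hKpd (w := w) (S := S) (fun i => rfl) hw
    have h2 := objective_diagonal_conj lam hRpd.inv (w := w) (S := S) (fun i => rfl) hw
    have h3 : Matrix.diagonal w⁻¹ * K * Matrix.diagonal w⁻¹ = Θ := by
      calc _ = (Matrix.diagonal w⁻¹ * Matrix.diagonal w) * Θ *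
            (Matrix.diagonal w * Matrix.diagonal w⁻¹) := by simp only [hKdef, mul_assoc]
        _ = Θ := by rw [diagonal_inv_mul_diagonal hw0, diagonal_mul_diagonal_inv hw0, one_mul,
                      mul_one]
    rw [h3] at h1
    have h4 := hΘ.2 _ (posDef_diagonal_conj (w := w⁻¹) (fun i => by simp [hw0 i]) hRpd.inv)
    rw [h1, h2] at h4
    linarith
  have hsq : √s₀ ≤ s₀ := by
    rw [Real.sqrt_le_left (by linarith)]; nlinarith
  have hcond' : 8 * lam * √s₀ ≤ (M ^ 2)⁻¹ := by
    rw [le_div_iff₀ (by positivity)] at hcond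
    rw [← one_div, le_div_iff₀ (by positivity)]
    calc 8 * lam * √s₀ * M ^ 2 ≤ 8 * lam * s₀ * M ^ 2 := by gcongr
      _ ≤ 1 := by linarith
  obtain ⟨hF, hO⟩ := graphicalLasso_oracle hRpd hKpd (by positivity) hRℓ hlam hsR hRdiag hRE
    hcond' hmin
  set D := K - R⁻¹ with hD
  have hdivM : ∀ x : ℝ, x / (M ^ 2)⁻¹ ^ 2 = x * M ^ 4 := by
    intro x; rw [inv_pow, div_inv_eq_mul]; ring
  rw [hdivM] at hF hO
  have hF2 : frobSq D ≤ 256 * M ^ 8 * (lam ^ 2 * s₀) := by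
    rw [← Real.sq_sqrt (frobSq_nonneg D)]
    calc √(frobSq D) ^ 2 ≤ (16 * lam * √s₀ * M ^ 4) ^ 2 := by gcongr
      _ = 256 * M ^ 8 * (lam ^ 2 * (√s₀) ^ 2) := by ring
      _ = _ := by rw [Real.sq_sqrt (by linarith)]
  have hDrow2 : ∑ j, D i j ^ 2 ≤ frobSq D :=
    Finset.single_le_sum (f := fun i => ∑ j, D i j ^ 2)
      (fun i _ => Finset.sum_nonneg fun j _ => sq_nonneg _) (Finset.mem_univ i)
  have hDrow1 : ∑ j, |D i j| ≤ 80 * M ^ 4 * (lam * s₀) := by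
    have h1 : ∑ j, |D i j| = |D i i| + ∑ j, if i ≠ j then |D i j| else 0 := by
      have : |D i i| = ∑ j, if i = j then |D i j| else 0 := by simp
      rw [this, ← Finset.sum_add_distrib]
      refine Finset.sum_congr rfl fun j _ => ?_
      by_cases hij : i = j <;> simp [hij]
    have h2 : (∑ j, if i ≠ j then |D i j| else 0) ≤ offSum D :=
      Finset.single_le_sum (f := fun i => ∑ j, if i ≠ j then |D i j| else 0)
        (fun i _ => Finset.sum_nonneg fun j _ => by split_ifs <;> positivity) (Finset.mem_univ i)
    have h3 : |D i i| ≤ √(frobSq D) := Real.abs_le_sqrt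
      ((Finset.single_le_sum (f := fun j => D i j ^ 2) (fun j _ => sq_nonneg _)
        (Finset.mem_univ i)).trans hDrow2)
    have h4 : 16 * lam * √s₀ * M ^ 4 ≤ 16 * lam * s₀ * M ^ 4 := by gcongr
    rw [h1]
    linarith
  have hrow := inv_row_sq_le hSig hM0 hlow i
  have hΔ : ∀ j, |(Θ - Sig⁻¹) i j| ≤ 2 * M * |D i j| + lam * |Sig⁻¹ i j| := by
    intro j
    have h1 : (Θ - Sig⁻¹) i j = (w i)⁻¹ * (w j)⁻¹ * D i j + Sig⁻¹ i j * (r i * r j - 1) := by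
      rw [hD, Matrix.sub_apply, Matrix.sub_apply, hRinv, hKdef, diagonal_conj_apply,
        diagonal_conj_apply]
      simp only [r]
      have := hw0 i; have := hw0 j
      field_simp
      ring
    rw [h1]
    refine (abs_add_le _ _).trans ?_
    rw [abs_mul, abs_mul (Sig⁻¹ i j), abs_of_pos (mul_pos (inv_pos.2 (hw i)) (inv_pos.2 (hw j))),
      mul_comm (|Sig⁻¹ i j|)]
    exact add_le_add (mul_le_mul_of_nonneg_right (hwi i j) (abs_nonneg _))
      (mul_le_mul_of_nonneg_right (by linarith [hrr i j]) (abs_nonneg _))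
  have hMpow : ∀ k : ℕ, 1 ≤ M ^ k := fun k => one_le_pow₀ hM
  constructor
  · have h1 : ∀ j, (Θ - Sig⁻¹) i j ^ 2 ≤ 8 * M ^ 2 * D i j ^ 2 + 2 * lam ^ 2 * Sig⁻¹ i j ^ 2 := by
      intro j
      have h2 : |(Θ - Sig⁻¹) i j| ^ 2 ≤ (2 * M * |D i j| + lam * |Sig⁻¹ i j|) ^ 2 := by
        gcongr; exact hΔ j
      rw [sq_abs] at h2
      refine h2.trans ?_
      rw [← sq_abs (D i j), ← sq_abs (Sig⁻¹ i j)]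
      nlinarith [sq_nonneg (2 * M * |D i j| - lam * |Sig⁻¹ i j|)]
    calc ∑ j, (Θ - Sig⁻¹) i j ^ 2
        ≤ ∑ j, (8 * M ^ 2 * D i j ^ 2 + 2 * lam ^ 2 * Sig⁻¹ i j ^ 2) :=
          Finset.sum_le_sum fun j _ => h1 j
      _ = 8 * M ^ 2 * ∑ j, D i j ^ 2 + 2 * lam ^ 2 * ∑ j, Sig⁻¹ i j ^ 2 := by
          rw [Finset.sum_add_distrib, Finset.mul_sum, Finset.mul_sum]
      _ ≤ 8 * M ^ 2 * (256 * M ^ 8 * (lam ^ 2 * s₀)) + 2 * lam ^ 2 * M ^ 2 := by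
          gcongr; exact hDrow2.trans hF2
      _ ≤ 8 * M ^ 2 * (256 * M ^ 8 * (lam ^ 2 * s₀)) + 2 * lam ^ 2 * (M ^ 10 * s₀) := by
          gcongr
          calc M ^ 2 ≤ M ^ 10 := pow_le_pow_right₀ hM (by norm_num)
            _ ≤ M ^ 10 * s₀ := le_mul_of_one_le_right (by positivity) hs₀
      _ = 2050 * M ^ 10 * (lam ^ 2 * s₀) := by ring
  · have hdeg : (maxDegree Sig⁻¹ : ℝ) ≤ s₀ :=
      le_trans (by exact_mod_cast maxDegree_le_sparsity _) hs
    have h1 := sum_abs_row_le Sig⁻¹ (transpose_eq_of_posSemidef hSig.inv.posSemidef) hM0.le hs₀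
      hdeg i hrow
    calc ∑ j, |(Θ - Sig⁻¹) i j| ≤ ∑ j, (2 * M * |D i j| + lam * |Sig⁻¹ i j|) :=
          Finset.sum_le_sum fun j _ => hΔ j
      _ = 2 * M * ∑ j, |D i j| + lam * ∑ j, |Sig⁻¹ i j| := by
          rw [Finset.sum_add_distrib, Finset.mul_sum, Finset.mul_sum]
      _ ≤ 2 * M * (80 * M ^ 4 * (lam * s₀)) + lam * (2 * M ^ 5 * s₀) := by
          gcongr
          refine h1.trans ?_
          gcongr
          exact le_self_pow₀ hM (by norm_num)
      _ = 162 * M ^ 5 * (lam * s₀) := by ring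

/-- Bound for the entries of `A * E * B` with `A` a row and `B` a column. -/
lemma abs_mul_mul_apply_le (A E B : Matrix (Fin d) (Fin d) ℝ) (i j : Fin d) {e α β : ℝ}
    (he : ∀ k l, |E k l| ≤ e) (hα : ∑ k, |A i k| ≤ α) (hβ : ∑ l, |B l j| ≤ β) (he0 : 0 ≤ e) :
    |(A * E * B) i j| ≤ e * α * β := by
  have hα0 : 0 ≤ α := (Finset.sum_nonneg fun _ _ => abs_nonneg _).trans hα
  have h1 : ∀ l, |(A * E) i l| ≤ e * α := by
    intro l
    rw [Matrix.mul_apply]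
    calc _ ≤ ∑ k, |A i k * E k l| := Finset.abs_sum_le_sum_abs _ _
      _ ≤ ∑ k, |A i k| * e := Finset.sum_le_sum fun k _ => by
          rw [abs_mul]; gcongr; exact he k l
      _ = e * ∑ k, |A i k| := by rw [← Finset.sum_mul, mul_comm]
      _ ≤ e * α := by gcongr
  rw [Matrix.mul_apply]
  calc _ ≤ ∑ l, |(A * E) i l * B l j| := Finset.abs_sum_le_sum_abs _ _
    _ ≤ ∑ l, e * α * |B l j| := Finset.sum_le_sum fun l _ => by
        rw [abs_mul]; gcongr; exact h1 l
    _ = e * α * ∑ l, |B l j| := by rw [Finset.mul_sum]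
    _ ≤ e * α * β := by gcongr

/-- Entrywise bound for the remainder of the linearization of the de-biased estimator. -/
lemma debiased_remainder_le {Sig S Θ : Matrix (Fin d) (Fin d) ℝ} (hSig : Sig.PosDef)
    {M lam s₀ g : ℝ} (hM : 1 ≤ M) (hlow : (Sig - M⁻¹ • 1).PosSemidef)
    (hup : (M • 1 - Sig).PosSemidef) (hlam : 0 < lam) (hs₀ : 1 ≤ s₀)
    (hs : (sparsity Sig⁻¹ : ℝ) ≤ s₀) (hg : 1 ≤ g) (hdeg : (maxDegree Sig⁻¹ : ℝ) ≤ g)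
    (hE : ∀ i j, |S i j - Sig i j| ≤ lam / (16 * M)) (hcond : lam * s₀ ≤ 1 / (8 * M ^ 2))
    (hΘ : IsMinimizer S lam Θ) (i j : Fin d) :
    |(Θ - -(Θ - Θ * S * Θ) - Sig⁻¹ + Sig⁻¹ * (S - Sig) * Sig⁻¹) i j| ≤
      30000 * M ^ 11 * (lam ^ 2 * s₀ * √g) := by
  have hM0 : 0 < M := by linarith
  have hrates := minimizer_rates hSig hM hlow hlam hs₀ hs hE hcond hup hΘ
  set Θ₀ := Sig⁻¹ with hΘ₀
  set E := S - Sig with hEdef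
  set Δ := Θ - Θ₀ with hΔdef
  have hSigu : IsUnit Sig.det := (Matrix.isUnit_iff_isUnit_det _).1 hSig.isUnit
  have h10 : Θ₀ * Sig = 1 := Matrix.nonsing_inv_mul _ hSigu
  have h01 : Sig * Θ₀ = 1 := Matrix.mul_nonsing_inv _ hSigu
  have hdecomp : Θ - -(Θ - Θ * S * Θ) - Θ₀ + Θ₀ * E * Θ₀ =
      -(Δ * E * Θ₀ + Θ₀ * E * Δ + (Δ * Sig * Δ + Δ * E * Δ)) := by
    have e1 : Θ = Θ₀ + Δ := by rw [hΔdef]; abel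
    have e2 : S = Sig + E := by rw [hEdef]; abel
    have e3 : Δ * Sig * Θ₀ = Δ := by rw [mul_assoc, h01, mul_one]
    rw [e1, e2]
    simp only [add_mul, mul_add, h10, one_mul, e3]
    abel
  have hE' : ∀ i j, |E i j| ≤ lam / (16 * M) := hE
  have hΔt : Δ.transpose = Δ := by
    rw [hΔdef, Matrix.transpose_sub, transpose_eq_of_posSemidef hΘ.1.posSemidef,
      transpose_eq_of_posSemidef hSig.inv.posSemidef]
  have hΘ₀t : Θ₀.transpose = Θ₀ := transpose_eq_of_posSemidef hSig.inv.posSemidef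
  have hΔs : ∀ a b, Δ a b = Δ b a := fun a b => congrFun (congrFun hΔt b) a
  have hΘ₀s : ∀ a b, Θ₀ a b = Θ₀ b a := fun a b => congrFun (congrFun hΘ₀t b) a
  set α := 162 * M ^ 5 * (lam * s₀)
  have hΔr : ∀ a, ∑ b, |Δ a b| ≤ α := fun a => (hrates a).2
  have hΔc : ∀ b, ∑ a, |Δ a b| ≤ α := fun b => by simpa only [hΔs _ b] using hΔr b
  set β := 2 * M * √g
  have hΘr : ∀ a, ∑ b, |Θ₀ a b| ≤ β := fun a =>
    sum_abs_row_le Θ₀ hΘ₀t hM0.le hg hdeg a (inv_row_sq_le hSig hM0 hlow a)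
  have hΘc : ∀ b, ∑ a, |Θ₀ a b| ≤ β := fun b => by simpa only [hΘ₀s _ b] using hΘr b
  have he0 : 0 ≤ lam / (16 * M) := by positivity
  have b1 := abs_mul_mul_apply_le Δ E Θ₀ i j hE' (hΔr i) (hΘc j) he0
  have b2 := abs_mul_mul_apply_le Θ₀ E Δ i j hE' (hΘr i) (hΔc j) he0
  have b3 := abs_mul_mul_apply_le Δ E Δ i j hE' (hΔr i) (hΔc j) he0
  have b4 : |(Δ * Sig * Δ) i j| ≤ M * (2050 * M ^ 10 * (lam ^ 2 * s₀)) := by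
    have h1 : (Δ * Sig * Δ) i j = Δ i ⬝ᵥ Sig.mulVec (Δ j) := by
      rw [mul_assoc, Matrix.mul_apply]
      refine Finset.sum_congr rfl fun k _ => ?_
      congr 1
      rw [Matrix.mul_apply]
      exact Finset.sum_congr rfl fun l _ => by rw [hΔs l j]
    rw [h1]
    have h2 : ∀ a, Δ a ⬝ᵥ Δ a ≤ 2050 * M ^ 10 * (lam ^ 2 * s₀) := fun a => by
      refine le_trans (le_of_eq ?_) (hrates a).1
      simp only [dotProduct, sq]
    exact quad_le_of_le_smul_one hSig.posSemidef hM0.le hup _ _ (h2 i) (h2 j)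
  have hsg : 1 ≤ √g := Real.one_le_sqrt.2 hg
  set X := lam ^ 2 * s₀ * √g
  have hX : lam ^ 2 * s₀ ≤ X := le_mul_of_one_le_right (by positivity) hsg
  have hX0 : 0 ≤ X := by positivity
  have c1 : lam / (16 * M) * α * β ≤ 41 * M ^ 11 * X := by
    calc lam / (16 * M) * α * β = 162 * 2 / 16 * M ^ 5 * X := by
          simp only [α, β, X]; field_simp
      _ ≤ 41 * M ^ 11 * X := by
          gcongr
          · norm_num
          · norm_num
  have c2 : lam / (16 * M) * β * α ≤ 41 * M ^ 11 * X := by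
    calc _ = lam / (16 * M) * α * β := by ring
      _ ≤ _ := c1
  have c3 : lam / (16 * M) * α * α ≤ 206 * M ^ 11 * X := by
    calc lam / (16 * M) * α * α = 162 ^ 2 / 16 * M ^ 9 * (lam ^ 2 * s₀) * (lam * s₀) := by
          simp only [α]; field_simp
      _ ≤ 162 ^ 2 / 16 * M ^ 9 * (lam ^ 2 * s₀) * (1 / (8 * M ^ 2)) := by gcongr
      _ = 162 ^ 2 / 128 * M ^ 7 * (lam ^ 2 * s₀) := by field_simp; ring
      _ ≤ 206 * M ^ 11 * X := by
          gcongr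
          · norm_num
          · norm_num
  have c4 : M * (2050 * M ^ 10 * (lam ^ 2 * s₀)) ≤ 2050 * M ^ 11 * X := by
    calc _ = 2050 * M ^ 11 * (lam ^ 2 * s₀) := by ring
      _ ≤ _ := by gcongr
  rw [hdecomp, Matrix.neg_apply, abs_neg, Matrix.add_apply, Matrix.add_apply, Matrix.add_apply]
  have hfin : 0 ≤ M ^ 11 * X := by positivity
  calc _ ≤ |(Δ * E * Θ₀) i j| + |(Θ₀ * E * Δ) i j| + |(Δ * Sig * Δ) i j + (Δ * E * Δ) i j| :=
        abs_add_three _ _ _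
    _ ≤ |(Δ * E * Θ₀) i j| + |(Θ₀ * E * Δ) i j| + (|(Δ * Sig * Δ) i j| + |(Δ * E * Δ) i j|) := by
        gcongr; exact abs_add_le _ _
    _ ≤ _ := by nlinarith

end Precision

/-! ### Spectral bounds and quadratic covariation -/

section Spectrum

variable {d : ℕ}

lemma bounds_of_lambda {A : Matrix (Fin d) (Fin d) ℝ} (hd : 0 < d) (hA : A.PosDef) {M : ℝ}
    (h : lambdaMax A + 1 / lambdaMin A ≤ M) :
    (A - M⁻¹ • 1).PosSemidef ∧ (M • 1 - A).PosSemidef := by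
  have : Nonempty (Fin d) := ⟨⟨0, hd⟩⟩
  have hsp := hA.isHermitian.spectrum_real_eq_range_eigenvalues
  have hfin : (spectrum ℝ A).Finite := by rw [hsp]; exact Set.finite_range _
  have hne : (spectrum ℝ A).Nonempty := by rw [hsp]; exact Set.range_nonempty _
  have hpos : ∀ x ∈ spectrum ℝ A, 0 < x := by
    rw [hsp]
    rintro x ⟨i, rfl⟩
    exact hA.eigenvalues_pos i
  have hmin : 0 < lambdaMin A := hpos _ (hne.csInf_mem hfin)
  have hmax : 0 < lambdaMax A := hpos _ (hne.csSup_mem hfin)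
  have hmin1 : 0 < 1 / lambdaMin A := by positivity
  have hM : 0 < M := by linarith
  have hminM : M⁻¹ ≤ lambdaMin A := by
    have h1 : 1 / lambdaMin A ≤ M := by linarith
    rw [inv_le_comm₀ hM hmin, ← one_div]
    exact h1
  have h1 : ∀ c : ℝ, c • (1 : Matrix (Fin d) (Fin d) ℝ) = algebraMap ℝ _ c := fun c =>
    (Algebra.algebraMap_eq_smul_one c).symm
  have hc : ∀ c : ℝ, (c • (1 : Matrix (Fin d) (Fin d) ℝ)).IsHermitian := fun c => by
    rw [Matrix.IsHermitian, Matrix.conjTranspose_smul, Matrix.conjTranspose_one, star_trivial]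
  rw [Matrix.posSemidef_iff_isHermitian_and_spectrum_nonneg,
    Matrix.posSemidef_iff_isHermitian_and_spectrum_nonneg]
  refine ⟨⟨hA.isHermitian.sub (hc _), fun x hx => ?_⟩, ⟨(hc _).sub hA.isHermitian, fun x hx => ?_⟩⟩
  · rw [h1, ← spectrum.sub_singleton_eq] at hx
    obtain ⟨y, hy, z, rfl, rfl⟩ := Set.mem_sub.1 hx
    have := csInf_le hfin.bddBelow hy
    show 0 ≤ y - M⁻¹
    unfold lambdaMin at hminM
    linarith
  · rw [h1, ← spectrum.singleton_sub_eq] at hx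
    obtain ⟨z, rfl, y, hy, rfl⟩ := Set.mem_sub.1 hx
    have h2 := le_csSup hfin.bddAbove hy
    show 0 ≤ z - y
    unfold lambdaMax at h
    linarith

/-- The uniform partition of `[0,1]` into `k + 1` intervals. -/
def uniformPartition (k l : ℕ) : unitInterval :=
  ⟨min ((l : ℝ) / (k + 1)) 1, le_min (by positivity) zero_le_one, min_le_right _ _⟩

lemma IsQuadCov.ae_posSemidef {Ω : Type*} [MeasurableSpace Ω] {P : Measure Ω}
    {Y : unitInterval → Ω → Fin d → ℝ} {Q : Ω → Matrix (Fin d) (Fin d) ℝ}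
    (h : IsQuadCov P Y Q) : ∀ᵐ ω ∂P, (Q ω).PosSemidef := by
  set t := uniformPartition with ht
  have hconv := h (fun k => k + 1) t (by
    intro k
    refine ⟨?_, ?_, ?_⟩
    · ext; simp [ht, uniformPartition]
    · intro a b hab
      rw [← Subtype.coe_le_coe]
      simp only [ht, uniformPartition]
      gcongr
    · ext
      have : ((k : ℝ) + 1) / (k + 1) = 1 := div_self (by positivity)
      simp [ht, uniformPartition, this]) (by
    intro ε hε
    obtain ⟨K, hK⟩ := exists_nat_one_div_lt hε
    filter_upwards [eventually_ge_atTop K] with k hk l hl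
    refine lt_of_le_of_lt ?_ hK
    have h1 : ((l : ℝ) + 1) / (k + 1) ≤ 1 := by
      rw [div_le_one (by positivity)]
      exact_mod_cast hl
    have h2 : (l : ℝ) / (k + 1) ≤ 1 := by
      refine le_trans ?_ h1
      gcongr
      linarith
    simp only [ht, uniformPartition, Nat.cast_add, Nat.cast_one]
    rw [min_eq_left h1, min_eq_left h2, ← sub_div, add_sub_cancel_left]
    gcongr)
  set V : ℕ → Ω → Matrix (Fin d) (Fin d) ℝ := fun k ω => ∑ l ∈ Finset.range (k + 1),
    Matrix.vecMulVec (Y (t k (l + 1)) ω - Y (t k l) ω) (star (Y (t k (l + 1)) ω - Y (t k l) ω))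
  have hV : ∀ k ω, (V k ω).PosSemidef := fun k ω =>
    Matrix.posSemidef_sum _ fun l _ => Matrix.posSemidef_vecMulVec_self_star _
  have hVapp : ∀ k ω i j, V k ω i j = ∑ l ∈ Finset.range (k + 1),
      (Y (t k (l + 1)) ω i - Y (t k l) ω i) * (Y (t k (l + 1)) ω j - Y (t k l) ω j) := by
    intro k ω i j
    simp [V, Matrix.sum_apply, Matrix.vecMulVec_apply]
  have hae : ∀ N : ℕ, ∀ᵐ ω ∂P, ∃ k, ∀ i j, |V k ω i j - Q ω i j| < 1 / ((N : ℝ) + 1) := by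
    intro N
    have hN : (0 : ℝ≥0∞) < ENNReal.ofReal (1 / ((N : ℝ) + 1)) := by
      rw [ENNReal.ofReal_pos]; positivity
    have hsum : Tendsto (fun k => ∑ i, ∑ j, P {ω | ENNReal.ofReal (1 / ((N : ℝ) + 1)) ≤
        edist (V k ω i j) (Q ω i j)}) atTop (𝓝 0) := by
      have := tendsto_finsetSum (Finset.univ : Finset (Fin d)) fun i _ =>
        tendsto_finsetSum (Finset.univ : Finset (Fin d)) fun j _ => hconv i j _ hN
      simpa only [Finset.sum_const_zero, hVapp] using this
    rw [ae_iff]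
    refine le_antisymm (ge_of_tendsto' hsum fun k => ?_) zero_le
    refine le_trans (measure_mono (t := ⋃ i, ⋃ j, {ω | ENNReal.ofReal (1 / ((N : ℝ) + 1)) ≤
        edist (V k ω i j) (Q ω i j)}) ?_)
      ((measure_iUnion_fintype_le _ _).trans (Finset.sum_le_sum fun i _ =>
        measure_iUnion_fintype_le _ _))
    intro ω hω
    have hω' : ¬ ∃ k, ∀ i j, |V k ω i j - Q ω i j| < 1 / ((N : ℝ) + 1) := hω
    push Not at hω'
    obtain ⟨i, j, hij⟩ := hω' k
    refine Set.mem_iUnion.2 ⟨i, Set.mem_iUnion.2 ⟨j, ?_⟩⟩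
    show _ ≤ edist _ _
    rw [edist_dist, Real.dist_eq]
    exact ENNReal.ofReal_le_ofReal hij
  rw [← ae_all_iff] at hae
  filter_upwards [hae] with ω hω
  choose k hk using hω
  have hlim : Tendsto (fun N => V (k N) ω) atTop (𝓝 (Q ω)) := by
    refine tendsto_pi_nhds.2 fun i => tendsto_pi_nhds.2 fun j => ?_
    refine tendsto_iff_dist_tendsto_zero.2 (squeeze_zero (fun _ => dist_nonneg)
      (fun N => ?_) tendsto_one_div_add_atTop_nhds_zero_nat)
    rw [Real.dist_eq]
    exact (hk N i j).le
  have hmem : Q ω ∈ {A : Matrix (Fin d) (Fin d) ℝ | A.PosSemidef} :=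
    isClosed_posSemidef.mem_of_tendsto hlim (Eventually.of_forall fun N => hV _ _)
  exact hmem

end Spectrum

/-! ### Measurability of matrix-valued maps -/

section Measurability

variable {Ω : Type*} [MeasurableSpace Ω]

lemma measurable_comp_matrix {κ : Type*} [Fintype κ] {f : Matrix κ κ ℝ → ℝ} (hf : Continuous f)
    {A : Ω → Matrix κ κ ℝ} (hA : ∀ i j, Measurable fun ω => A ω i j) :
    Measurable fun ω => f (A ω) := by
  have h1 : Measurable (fun ω => (fun i j => A ω i j : κ → κ → ℝ)) :=
    measurable_pi_lambda _ fun i => measurable_pi_lambda _ fun j => hA i j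
  have h2 : Continuous fun B : κ → κ → ℝ => f (Matrix.of B) := hf
  exact h2.measurable.comp h1

lemma measurable_matrix_mul {ι κ τ : Type*} [Fintype κ] {A : Ω → Matrix ι κ ℝ}
    {B : Ω → Matrix κ τ ℝ} (hA : ∀ i j, Measurable fun ω => A ω i j)
    (hB : ∀ i j, Measurable fun ω => B ω i j) (i : ι) (j : τ) :
    Measurable fun ω => (A ω * B ω) i j := by
  simp only [Matrix.mul_apply]
  exact Finset.measurable_fun_sum _ fun k _ => (hA i k).mul (hB k j)

lemma measurable_matrix_inv {κ : Type*} [Fintype κ] [DecidableEq κ] {A : Ω → Matrix κ κ ℝ}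
    (hA : ∀ i j, Measurable fun ω => A ω i j) (i j : κ) : Measurable fun ω => (A ω)⁻¹ i j := by
  simp only [Matrix.inv_def, Ring.inverse_eq_inv', Matrix.smul_apply, smul_eq_mul]
  exact (measurable_comp_matrix continuous_id.matrix_det hA).inv.mul
    (measurable_comp_matrix (f := fun A => A.adjugate i j)
      (continuous_id.matrix_adjugate.matrix_elem i j) hA)

lemma measurable_tildeJ {m d : ℕ} {J : Ω → Matrix (Fin m) (Fin d × Fin d) ℝ}
    {Θ : Ω → Matrix (Fin d) (Fin d) ℝ} (hJ : ∀ i j, Measurable fun ω => J ω i j)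
    (hΘ : ∀ i j, Measurable fun ω => Θ ω i j) (i : Fin m) (j : Fin d × Fin d) :
    Measurable fun ω => tildeJ (J ω) (Θ ω) i j := by
  simp only [tildeJ, Matrix.neg_apply]
  refine (measurable_matrix_mul hJ (fun a b => ?_) i j).neg
  simp only [Matrix.kroneckerMap_apply]
  exact (hΘ _ _).mul (hΘ _ _)

lemma measurableSet_posSemidef {d : Type*} [Fintype d] {A : Ω → Matrix d d ℝ}
    (hA : ∀ i j, Measurable fun ω => A ω i j) : MeasurableSet {ω | (A ω).PosSemidef} := by
  have h1 : Measurable (fun ω => (fun i j => A ω i j : d → d → ℝ)) :=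
    measurable_pi_lambda _ fun i => measurable_pi_lambda _ fun j => hA i j
  have h2 : IsClosed {A : Matrix d d ℝ | A.PosSemidef} := isClosed_posSemidef
  exact h1 (IsClosed.measurableSet (α := d → d → ℝ) h2)

open scoped Matrix.Norms.L2Operator in
lemma continuousOn_matrix_sqrt {κ : Type*} [Fintype κ] [DecidableEq κ] :
    ContinuousOn (CFC.sqrt : Matrix κ κ ℝ → Matrix κ κ ℝ) {A | A.PosSemidef} := by
  have h : {A : Matrix κ κ ℝ | A.PosSemidef} = {A | 0 ≤ A} := by
    ext A; exact Matrix.nonneg_iff_posSemidef.symm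
  rw [h]
  exact CFC.continuousOn_sqrt

lemma measurable_matrix_sqrt {κ : Type*} [Fintype κ] [DecidableEq κ] {C : Ω → Matrix κ κ ℝ}
    (hC : ∀ i j, Measurable fun ω => C ω i j) (hpsd : ∀ ω, (C ω).PosSemidef) (i j : κ) :
    Measurable fun ω => CFC.sqrt (C ω) i j := by
  have h1 : Measurable (fun ω => (fun i j => C ω i j : κ → κ → ℝ)) :=
    measurable_pi_lambda _ fun i => measurable_pi_lambda _ fun j => hC i j
  let T : Set (κ → κ → ℝ) := {A | (Matrix.of A : Matrix κ κ ℝ).PosSemidef}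
  have h2 : Measurable fun ω => (⟨fun i j => C ω i j, hpsd ω⟩ : T) := h1.subtype_mk
  have h3 : Continuous fun A : T => (CFC.sqrt (Matrix.of A.1 : Matrix κ κ ℝ)) i j := by
    have := continuousOn_iff_continuous_domRestrict.1 (continuousOn_matrix_sqrt (κ := κ))
    exact this.matrix_elem i j
  exact h3.measurable.comp h2

end Measurability

/-! ### Anti-concentration of mixed-normal distributions -/

section MixedNormal

variable {Ω : Type*} [MeasurableSpace Ω] {P : Measure Ω} [IsProbabilityMeasure P]
  {κ : Type*} [Fintype κ] [DecidableEq κ]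

lemma measureReal_le_of_le {α : Type*} [MeasurableSpace α] {μ : Measure α} {s : Set α} {c : ℝ}
    (hc : 0 ≤ c) (h : μ s ≤ ENNReal.ofReal c) : μ.real s ≤ c :=
  ENNReal.toReal_le_of_le_ofReal hc h

lemma mixedNormalProb_add_le {m : ℕ} (hm : 1 ≤ m) {A : Ω → Matrix (Fin m) κ ℝ}
    {C : Ω → Matrix κ κ ℝ} (hA : ∀ i j, Measurable fun ω => A ω i j)
    (hC : ∀ i j, Measurable fun ω => C ω i j) (hpsd : ∀ᵐ ω ∂P, (C ω).PosSemidef)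
    {b δ : ℝ} (hb : 0 < b) (hδ : 0 < δ) (y : Fin m → ℝ) :
    mixedNormalProb P A C (fun k => y k + δ) ≤ mixedNormalProb P A C y +
      (45 * √(Real.log (m + 1)) * (δ / √b) +
        P.real {ω | ∃ k, (A ω * C ω * (A ω).transpose) k k < b}) := by
  classical
  set C' : Ω → Matrix κ κ ℝ := fun ω => if (C ω).PosSemidef then C ω else 0
  have hC'psd : ∀ ω, (C' ω).PosSemidef := by
    intro ω
    by_cases h : (C ω).PosSemidef
    · simp only [C', if_pos h, h]
    · simp only [C', if_neg h]; exact Matrix.PosSemidef.zero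
  have hC'meas : ∀ i j, Measurable fun ω => C' ω i j := by
    intro i j
    have : (fun ω => C' ω i j) = fun ω => if (C ω).PosSemidef then C ω i j else 0 := by
      ext ω
      by_cases h : (C ω).PosSemidef <;> simp [C', h]
    rw [this]
    exact Measurable.ite (measurableSet_posSemidef hC) (hC i j) measurable_const
  set B : Ω → Matrix (Fin m) κ ℝ := fun ω => A ω * CFC.sqrt (C' ω)
  have hB : ∀ i j, Measurable fun ω => B ω i j :=
    measurable_matrix_mul hA (measurable_matrix_sqrt hC'meas hC'psd)
  have hBB : ∀ ω, (C ω).PosSemidef → ∀ k, B ω k ⬝ᵥ B ω k =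
      (A ω * C ω * (A ω).transpose) k k := by
    intro ω hω k
    have hC' : C' ω = C ω := if_pos hω
    have hst : (CFC.sqrt (C ω)).transpose = CFC.sqrt (C ω) :=
      transpose_eq_of_posSemidef (Matrix.nonneg_iff_posSemidef.1 (CFC.sqrt_nonneg _))
    have h1 : A ω * C ω * (A ω).transpose = B ω * (B ω).transpose := by
      simp only [B, hC', Matrix.transpose_mul, hst]
      nth_rw 1 [← CFC.sqrt_mul_sqrt_self (C ω) (Matrix.nonneg_iff_posSemidef.2 hω)]
      simp only [Matrix.mul_assoc]
    rw [h1, Matrix.mul_apply]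
    rfl
  set c := 45 * √(Real.log (m + 1)) * (δ / √b)
  have hc : 0 ≤ c := by positivity
  set μ := P.prod (stdGauss κ)
  set E : (Fin m → ℝ) → Set (Ω × (κ → ℝ)) := fun y =>
    {p | ∀ k, (A p.1 * CFC.sqrt (C p.1)).mulVec p.2 k ≤ y k}
  set D : Set (Ω × (κ → ℝ)) :=
    {p | (∀ k, (B p.1).mulVec p.2 k ≤ y k + δ) ∧ ¬ ∀ k, (B p.1).mulVec p.2 k ≤ y k}
  set N : Set Ω := {ω | ¬ (C ω).PosSemidef}
  have hN : P N = 0 := hpsd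
  have hsub : E (fun k => y k + δ) ⊆ E y ∪ (D ∪ N ×ˢ Set.univ) := by
    intro p hp
    by_cases h1 : p ∈ E y
    · exact Or.inl h1
    right
    by_cases h2 : (C p.1).PosSemidef
    · left
      have hBp : B p.1 = A p.1 * CFC.sqrt (C p.1) := by simp only [B, C', if_pos h2]
      simp only [D, Set.mem_ofPred_eq, hBp]
      exact ⟨hp, h1⟩
    · exact Or.inr ⟨h2, trivial⟩
  have hmv : ∀ k, Measurable fun p : Ω × (κ → ℝ) => (B p.1).mulVec p.2 k := by
    intro k
    simp only [Matrix.mulVec, dotProduct]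
    exact Finset.measurable_fun_sum _ fun j _ =>
      ((hB k j).comp measurable_fst).mul ((measurable_pi_apply j).comp measurable_snd)
  have hle : ∀ z : Fin m → ℝ, MeasurableSet {p : Ω × (κ → ℝ) | ∀ k, (B p.1).mulVec p.2 k ≤ z k} := by
    intro z
    have : {p : Ω × (κ → ℝ) | ∀ k, (B p.1).mulVec p.2 k ≤ z k} =
        ⋂ k, {p | (B p.1).mulVec p.2 k ≤ z k} := by ext; simp
    rw [this]
    exact MeasurableSet.iInter fun k => measurableSet_le (hmv k) measurable_const
  have hD : MeasurableSet D := (hle fun k => y k + δ).inter (hle y).compl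
  set U : Set Ω := {ω | ∃ k, B ω k ⬝ᵥ B ω k < b}
  have hU : MeasurableSet U := by
    have : U = ⋃ k, {ω | B ω k ⬝ᵥ B ω k < b} := by ext; simp [U]
    rw [this]
    refine MeasurableSet.iUnion fun k => measurableSet_lt ?_ measurable_const
    simp only [dotProduct]
    exact Finset.measurable_fun_sum _ fun j _ => (hB k j).mul (hB k j)
  have hDμ : μ D ≤ ENNReal.ofReal c + P U := by
    rw [Measure.prod_apply hD]
    calc ∫⁻ ω, (stdGauss κ) (Prod.mk ω ⁻¹' D) ∂P
        ≤ ∫⁻ ω, (ENNReal.ofReal c + U.indicator 1 ω) ∂P := by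
          refine lintegral_mono fun ω => ?_
          by_cases hω : ω ∈ U
          · rw [Set.indicator_of_mem hω]
            exact prob_le_one.trans le_add_self
          · have hω' : ∀ k, b ≤ B ω k ⬝ᵥ B ω k := by
              intro k
              by_contra hcon
              exact hω ⟨k, not_le.1 hcon⟩
            refine le_trans ?_ le_self_add
            have := stdGauss_layer_le hm (B ω) hb hω' y hδ
            rw [← ENNReal.ofReal_toReal (measure_ne_top (stdGauss κ) (Prod.mk ω ⁻¹' D))]
            exact ENNReal.ofReal_le_ofReal this
      _ = ENNReal.ofReal c + P U := by
          rw [lintegral_add_left measurable_const, lintegral_const, measure_univ, mul_one,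
            lintegral_indicator_one hU]
  have hDr : μ.real D ≤ c + P.real U := by
    refine measureReal_le_of_le (by positivity) (hDμ.trans (le_of_eq ?_))
    rw [ENNReal.ofReal_add hc measureReal_nonneg, ofReal_measureReal]
  have hNr : μ.real (N ×ˢ Set.univ) = 0 := by
    rw [measureReal_def, Measure.prod_prod, hN, zero_mul, ENNReal.toReal_zero]
  have hUr : P.real U ≤ P.real {ω | ∃ k, (A ω * C ω * (A ω).transpose) k k < b} := by
    have h1 : U ⊆ {ω | ∃ k, (A ω * C ω * (A ω).transpose) k k < b} ∪ N := by
      rintro ω ⟨k, hk⟩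
      by_cases h2 : (C ω).PosSemidef
      · exact Or.inl ⟨k, by rwa [← hBB ω h2]⟩
      · exact Or.inr h2
    refine (measureReal_mono h1).trans ((measureReal_union_le _ _).trans ?_)
    simp [measureReal_def, hN]
  calc mixedNormalProb P A C (fun k => y k + δ) = μ.real (E fun k => y k + δ) := rfl
    _ ≤ μ.real (E y) + (μ.real D + μ.real (N ×ˢ Set.univ)) :=
        (measureReal_mono hsub).trans ((measureReal_union_le _ _).trans
          (by gcongr; exact measureReal_union_le _ _))
    _ ≤ μ.real (E y) + (c + P.real {ω | ∃ k, (A ω * C ω * (A ω).transpose) k k < b}) := by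
        rw [hNr]; linarith
    _ = _ := rfl

/-- Stability of an approximation of orthant probabilities under small perturbations. -/
lemma abs_orthantProb_sub_le {m : ℕ} {X Z : Ω → Fin m → ℝ} {G : (Fin m → ℝ) → ℝ} {α β η δ : ℝ}
    (hZ : ∀ y, |orthantProb P Z y - G y| ≤ α) (hG : ∀ y, G (fun k => y k + δ) ≤ G y + β)
    (hXZ : P.real {ω | ∃ k, δ < |X ω k - Z ω k|} ≤ η) (y : Fin m → ℝ) :
    |orthantProb P X y - G y| ≤ α + β + η := by
  set D := {ω | ∃ k, δ < |X ω k - Z ω k|}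
  have h1 : orthantProb P X y ≤ orthantProb P Z (fun k => y k + δ) + P.real D := by
    refine (measureReal_mono ?_).trans (measureReal_union_le _ _)
    intro ω hω
    by_cases h : ω ∈ D
    · exact Or.inr h
    · refine Or.inl fun k => ?_
      have h2 : |X ω k - Z ω k| ≤ δ := not_lt.1 fun h3 => h ⟨k, h3⟩
      have h4 : X ω k ≤ y k := hω k
      show Z ω k ≤ y k + δ
      linarith [(abs_le.1 h2).1]
  have h2 : orthantProb P Z (fun k => y k - δ) ≤ orthantProb P X y + P.real D := by
    refine (measureReal_mono ?_).trans (measureReal_union_le _ _)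
    intro ω hω
    by_cases h : ω ∈ D
    · exact Or.inr h
    · refine Or.inl fun k => ?_
      have h2 : |X ω k - Z ω k| ≤ δ := not_lt.1 fun h3 => h ⟨k, h3⟩
      have h4 : Z ω k ≤ y k - δ := hω k
      show X ω k ≤ y k
      linarith [(abs_le.1 h2).2]
  have h3 := (abs_le.1 (hZ fun k => y k + δ)).2
  have h4 := (abs_le.1 (hZ fun k => y k - δ)).1
  have h5 := hG y
  have h6 := hG fun k => y k - δ
  simp only [sub_add_cancel] at h6
  rw [abs_le]
  constructor <;> linarith

end MixedNormal

/-! ### The linearization error of the de-biased estimator -/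

section Linearization

lemma abs_apply_le_maxNorm {ι κ : Type*} [Finite ι] [Finite κ] (A : Matrix ι κ ℝ) (i : ι) (j : κ) :
    |A i j| ≤ maxNorm A :=
  (le_ciSup (f := fun j => |A i j|) (Set.finite_range _).bddAbove j).trans
    (le_ciSup (f := fun i => ⨆ j, |A i j|) (Set.finite_range _).bddAbove i)

lemma abs_mulVec_le_opNormInf {ι κ : Type*} [Fintype ι] [Fintype κ] [DecidableEq κ]
    (A : Matrix ι κ ℝ) (x : κ → ℝ) {c : ℝ} (hc : 0 ≤ c) (hx : ∀ i, |x i| ≤ c) (k : ι) :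
    |A.mulVec x k| ≤ opNormInf A * c := by
  have h1 := (LinearMap.toContinuousLinearMap (Matrix.toLin' A)).le_opNorm x
  have h2 : ‖x‖ ≤ c := (pi_norm_le_iff_of_nonneg hc).2 hx
  calc |A.mulVec x k| ≤ ‖A.mulVec x‖ := norm_le_pi_norm (A.mulVec x) k
    _ ≤ opNormInf A * ‖x‖ := h1
    _ ≤ opNormInf A * c := by
        gcongr
        exact norm_nonneg _

/-- On the event where all the rates hold, the linearization error is small. -/
lemma linearization_error_le {d m : ℕ} (hd : 0 < d) {Sig S : Matrix (Fin d) (Fin d) ℝ}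
    (J : Matrix (Fin m) (Fin d × Fin d) ℝ) (hSig : Sig.PosDef) (hS : S.PosSemidef)
    (hdiag : ∀ i, 0 < S i i) {M lam s deg a : ℝ} (hM : 1 ≤ M) (hlam : 0 < lam)
    (hs : 1 ≤ s) (hdeg : 1 ≤ deg) (ha : 0 < a) (hL : lambdaMax Sig + 1 / lambdaMin Sig ≤ M)
    (hsp : (sparsity Sig⁻¹ : ℝ) ≤ M * s) (hmd : (maxDegree Sig⁻¹ : ℝ) ≤ M * deg)
    (hE : lam⁻¹ * maxNorm (S - Sig) ≤ 1 / (16 * M)) (hcond : s * lam ≤ 1 / (8 * M ^ 3))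
    (k : Fin m) :
    √(Real.log ((m : ℝ) + 1)) *
      |(a • J.mulVec (estimator S lam - bias S lam - Sig⁻¹).vec) k -
        (a • (tildeJ J Sig⁻¹).mulVec (S - Sig).vec) k| ≤
      30000 * M ^ 13 * (a * opNormInf J * lam ^ 2 * s * √(deg * Real.log ((m : ℝ) + 1))) := by
  have hM0 : 0 < M := by linarith
  obtain ⟨hlow, hup⟩ := bounds_of_lambda hd hSig hL
  have hΘ := estimator_isMinimizer hd hS hdiag hlam
  set Θ := estimator S lam
  set Rm := Θ - -(Θ - Θ * S * Θ) - Sig⁻¹ + Sig⁻¹ * (S - Sig) * Sig⁻¹ with hRm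
  have hMs : 1 ≤ M * s := by nlinarith
  have hMd : 1 ≤ M * deg := by nlinarith
  have hE' : ∀ i j, |S i j - Sig i j| ≤ lam / (16 * M) := by
    intro i j
    refine (abs_apply_le_maxNorm (S - Sig) i j).trans ?_
    rw [inv_mul_le_iff₀ hlam] at hE
    rwa [mul_one_div] at hE
  have hcond' : lam * (M * s) ≤ 1 / (8 * M ^ 2) := by
    calc lam * (M * s) = M * (s * lam) := by ring
      _ ≤ M * (1 / (8 * M ^ 3)) := by gcongr
      _ = 1 / (8 * M ^ 2) := by field_simp
  have hR : ∀ i j, |Rm i j| ≤ 30000 * M ^ 11 * (lam ^ 2 * (M * s) * √(M * deg)) :=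
    debiased_remainder_le hSig hM hlow hup hlam hMs hsp hMd hmd hE' hcond' hΘ
  have hdiff : (a • J.mulVec (Θ - bias S lam - Sig⁻¹).vec) k -
      (a • (tildeJ J Sig⁻¹).mulVec (S - Sig).vec) k = a * J.mulVec Rm.vec k := by
    have h1 : (tildeJ J Sig⁻¹).mulVec (S - Sig).vec =
        -J.mulVec (Sig⁻¹ * (S - Sig) * Sig⁻¹).vec := by
      rw [tildeJ, Matrix.neg_mulVec, ← Matrix.mulVec_mulVec, Matrix.kronecker_mulVec_vec,
        transpose_eq_of_posSemidef hSig.inv.posSemidef]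
    have h2 : bias S lam = -(Θ - Θ * S * Θ) := rfl
    rw [h1, h2, hRm, Matrix.vec_add, Matrix.mulVec_add]
    simp only [Pi.smul_apply, Pi.neg_apply, Pi.add_apply, smul_eq_mul]
    ring
  have hsqM : √(M * deg) ≤ M * √deg := by
    rw [Real.sqrt_mul hM0.le]
    gcongr
    rw [Real.sqrt_le_left hM0.le]
    nlinarith
  have hlog : 0 ≤ Real.log ((m : ℝ) + 1) := Real.log_nonneg (by linarith [Nat.cast_nonneg (α := ℝ) m])
  have hop : 0 ≤ opNormInf J := norm_nonneg _
  have hJ : |J.mulVec Rm.vec k| ≤ opNormInf J * (30000 * M ^ 11 * (lam ^ 2 * (M * s) * √(M * deg))) :=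
    abs_mulVec_le_opNormInf J _ (by positivity) (fun p => hR p.2 p.1) k
  rw [hdiff, abs_mul, abs_of_pos ha, Real.sqrt_mul (by linarith)]
  calc √(Real.log ((m : ℝ) + 1)) * (a * |J.mulVec Rm.vec k|)
      ≤ √(Real.log ((m : ℝ) + 1)) * (a * (opNormInf J *
          (30000 * M ^ 11 * (lam ^ 2 * (M * s) * (M * √deg))))) := by
        gcongr
        exact hJ.trans (by gcongr)
    _ = _ := by ring

end Linearization

/-! ### Asymptotic negligibility of the linearization error -/

section Asymptotics

variable {Ω : ℕ → Type*} [∀ n, MeasurableSpace (Ω n)] {P : ∀ n, Measure (Ω n)}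

lemma BigOp.eventually_le {X : ∀ n, Ω n → ℝ} {a : ℕ → ℝ} (h : BigOp P X a) (ha : ∀ n, 0 ≤ a n)
    {ε : ℝ≥0∞} (hε : 0 < ε) :
    ∃ M₀ : ℝ, ∀ M, M₀ ≤ M → ∀ᶠ n in atTop, P n {ω | ¬ X n ω ≤ M * a n} ≤ ε := by
  obtain ⟨M₀, hM₀⟩ := h ε hε
  refine ⟨M₀, fun M hM => hM₀.mono fun n hn => (measure_mono fun ω hω => ?_).trans hn⟩
  have h1 : M₀ * a n ≤ M * a n := mul_le_mul_of_nonneg_right hM (ha n)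
  exact h1.trans_lt ((not_le.1 hω).trans_le (le_abs_self _))

lemma TendstoZeroInProb.eventually_le {X : ∀ n, Ω n → ℝ} (h : TendstoZeroInProb P X)
    {c : ℝ} (hc : 0 < c) {ε : ℝ≥0∞} (hε : 0 < ε) :
    ∀ᶠ n in atTop, P n {ω | ¬ X n ω ≤ c} ≤ ε := by
  filter_upwards [(h c hc).eventually_le_const hε] with n hn
  exact (measure_mono fun ω hω => (not_le.1 hω).le.trans (le_abs_self _)).trans hn

lemma measure_not_and_le {α : Type*} [MeasurableSpace α] {μ : Measure α} {p q : α → Prop}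
    {ε₁ ε₂ : ℝ≥0∞} (hp : μ {x | ¬ p x} ≤ ε₁) (hq : μ {x | ¬ q x} ≤ ε₂) :
    μ {x | ¬ (p x ∧ q x)} ≤ ε₁ + ε₂ := by
  refine (measure_mono fun x hx => ?_).trans ((measure_union_le {x | ¬ p x} {x | ¬ q x}).trans
    (add_le_add hp hq))
  exact not_and_or.1 hx

lemma linearization_error_negligible
    (d : ℕ → ℕ) (hd : ∀ n, 2 ≤ d n)
    (SigmaY SigmaHat : ∀ n, Ω n → Matrix (Fin (d n)) (Fin (d n)) ℝ)
    (hSigmaY_pd : ∀ n, ∀ᵐ ω ∂(P n), (SigmaY n ω).PosDef)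
    (hSigmaHat_psd : ∀ n, ∀ᵐ ω ∂(P n), (SigmaHat n ω).PosSemidef)
    (hSigmaHat_diag : ∀ n, ∀ᵐ ω ∂(P n), ∀ i, 0 < SigmaHat n ω i i)
    (s deg : ℕ → ℝ) (hs : ∀ n, 1 ≤ s n) (hdeg : ∀ n, 1 ≤ deg n)
    (hEigen : BigOp P (fun n ω => lambdaMax (SigmaY n ω) + 1 / lambdaMin (SigmaY n ω))
      (fun _ => 1))
    (hSparse : BigOp P (fun n ω => (sparsity (SigmaY n ω)⁻¹ : ℝ)) s)
    (hDegree : BigOp P (fun n ω => (maxDegree (SigmaY n ω)⁻¹ : ℝ)) deg)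
    (lam : ∀ n, Ω n → ℝ) (hlam_pos : ∀ n, ∀ᵐ ω ∂(P n), 0 < lam n ω)
    (hEst : TendstoZeroInProb P
      (fun n ω => (lam n ω)⁻¹ * maxNorm (SigmaHat n ω - SigmaY n ω)))
    (hRate : TendstoZeroInProb P (fun n ω => s n * lam n ω))
    (a : ℕ → ℝ) (ha : ∀ n, 0 < a n) (m : ℕ → ℕ)
    (J : ∀ n, Ω n → Matrix (Fin (m n)) (Fin (d n) × Fin (d n)) ℝ)
    (hNegl : TendstoZeroInProb P
      (fun n ω => a n * opNormInf (J n ω) * lam n ω ^ 2 * s n *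
        √(deg n * Real.log ((m n : ℝ) + 1))))
    {c : ℝ} (hc : 0 < c) {ε : ℝ≥0∞} (hε : 0 < ε) :
    ∀ᶠ n in atTop, P n {ω | ¬ ∀ k, √(Real.log ((m n : ℝ) + 1)) *
      |(a n • (J n ω).mulVec (estimator (SigmaHat n ω) (lam n ω) -
          bias (SigmaHat n ω) (lam n ω) - (SigmaY n ω)⁻¹).vec) k -
        (a n • (tildeJ (J n ω) (SigmaY n ω)⁻¹).mulVec (SigmaHat n ω - SigmaY n ω).vec) k| ≤ c} ≤
      ε := by
  set ε' := ε / 6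
  have hε' : 0 < ε' := ENNReal.div_pos hε.ne' (by norm_num)
  obtain ⟨M₁, hM₁⟩ := hEigen.eventually_le (fun _ => zero_le_one) hε'
  obtain ⟨M₂, hM₂⟩ := hSparse.eventually_le (fun n => by linarith [hs n]) hε'
  obtain ⟨M₃, hM₃⟩ := hDegree.eventually_le (fun n => by linarith [hdeg n]) hε'
  set M := max 1 (max M₁ (max M₂ M₃))
  have hM : 1 ≤ M := le_max_left _ _
  have hM0 : 0 < M := by linarith
  have hMM₁ : M₁ ≤ M := (le_max_left _ _).trans (le_max_right _ _)
  have hMM₂ : M₂ ≤ M := (le_max_left _ _).trans ((le_max_right _ _).trans (le_max_right _ _))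
  have hMM₃ : M₃ ≤ M := (le_max_right _ _).trans ((le_max_right _ _).trans (le_max_right _ _))
  filter_upwards [hM₁ M hMM₁, hM₂ M hMM₂, hM₃ M hMM₃,
    hEst.eventually_le (c := 1 / (16 * M)) (by positivity) hε',
    hRate.eventually_le (c := 1 / (8 * M ^ 3)) (by positivity) hε',
    hNegl.eventually_le (c := c / (30000 * M ^ 13)) (by positivity) hε'] with n h1 h2 h3 h4 h5 h6
  have h0 : P n {ω | ¬ ((SigmaY n ω).PosDef ∧ (SigmaHat n ω).PosSemidef ∧
      (∀ i, 0 < SigmaHat n ω i i) ∧ 0 < lam n ω)} ≤ 0 := by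
    refine le_of_eq (ae_iff.1 ?_)
    filter_upwards [hSigmaY_pd n, hSigmaHat_psd n, hSigmaHat_diag n, hlam_pos n]
      with ω w1 w2 w3 w4 using ⟨w1, w2, w3, w4⟩
  have htot := measure_not_and_le h0 (measure_not_and_le h1 (measure_not_and_le h2
    (measure_not_and_le h3 (measure_not_and_le h4 (measure_not_and_le h5 h6)))))
  refine (measure_mono ?_).trans (htot.trans (le_of_eq ?_))
  · intro ω hω hgood
    refine hω fun k => ?_
    obtain ⟨⟨g1, g2, g3, g4⟩, g5, g6, g7, g8, g9, g10⟩ := hgood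
    refine (linearization_error_le (by have := hd n; omega) (J n ω) g1 g2 g3 hM g4 (hs n) (hdeg n)
      (ha n) (by simpa using g5) g6 g7 g8 g9 k).trans ?_
    rw [le_div_iff₀ (by positivity)] at g10
    linarith
  · have : ε' + ε' + ε' + ε' + ε' + ε' = ε := by
      calc _ = 6 * ε' := by ring
        _ = ε := ENNReal.mul_div_cancel (by norm_num) (by norm_num)
    rw [← this]
    ring

end Asymptotics

end WGLasso

end

theorem proposition3p2
    {Ω : ℕ → Type*} [∀ n, MeasurableSpace (Ω n)]
    (P : ∀ n, Measure (Ω n)) [∀ n, IsProbabilityMeasure (P n)]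
    -- the dimension, the process `Y`, its quadratic covariation matrix at time 1 and its estimator
    (d : ℕ → ℕ) (hd : ∀ n, 2 ≤ d n)
    (Y : ∀ n, unitInterval → Ω n → Fin (d n) → ℝ)
    (SigmaY SigmaHat : ∀ n, Ω n → Matrix (Fin (d n)) (Fin (d n)) ℝ)
    (hSigmaY_meas : ∀ n i j, Measurable fun ω => SigmaY n ω i j)
    (hSigmaY : ∀ n, WGLasso.IsQuadCov (P n) (Y n) (SigmaY n))
    (hSigmaY_inv : ∀ n, ∀ᵐ ω ∂(P n), IsUnit (SigmaY n ω))
    (hSigmaHat_meas : ∀ n i j, Measurable fun ω => SigmaHat n ω i j)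
    (hSigmaHat_psd : ∀ n, ∀ᵐ ω ∂(P n), (SigmaHat n ω).PosSemidef)
    (hSigmaHat_diag : ∀ n, ∀ᵐ ω ∂(P n), ∀ i, 0 < SigmaHat n ω i i)
    -- bounded spectrum and sparsity
    (s deg : ℕ → ℝ) (hs : ∀ n, 1 ≤ s n) (hdeg : ∀ n, 1 ≤ deg n)
    (hEigen : WGLasso.BigOp P
      (fun n ω => WGLasso.lambdaMax (SigmaY n ω) + 1 / WGLasso.lambdaMin (SigmaY n ω))
      (fun _ => 1))
    (hSparse : WGLasso.BigOp P (fun n ω => (WGLasso.sparsity (SigmaY n ω)⁻¹ : ℝ)) s)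
    (hDegree : WGLasso.BigOp P (fun n ω => (WGLasso.maxDegree (SigmaY n ω)⁻¹ : ℝ)) deg)
    -- the random penalty parameter
    (lam : ∀ n, Ω n → ℝ) (hlam_meas : ∀ n, Measurable (lam n))
    (hlam_pos : ∀ n, ∀ᵐ ω ∂(P n), 0 < lam n ω)
    (hEst : WGLasso.TendstoZeroInProb P
      (fun n ω => (lam n ω)⁻¹ * WGLasso.maxNorm (SigmaHat n ω - SigmaY n ω)))
    (hRate : WGLasso.TendstoZeroInProb P (fun n ω => s n * lam n ω))
    -- normalization, random linear functionals and random asymptotic covariance matrix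
    (a : ℕ → ℝ) (ha : ∀ n, 0 < a n) (m : ℕ → ℕ)
    (C : ∀ n, Ω n → Matrix (Fin (d n) × Fin (d n)) (Fin (d n) × Fin (d n)) ℝ)
    (hC_meas : ∀ n i j, Measurable fun ω => C n ω i j)
    (hC_psd : ∀ n, ∀ᵐ ω ∂(P n), (C n ω).PosSemidef)
    (J : ∀ n, Ω n → Matrix (Fin (m n)) (Fin (d n) × Fin (d n)) ℝ)
    (hJ_meas : ∀ n i j, Measurable fun ω => J n ω i j)
    (hNegl : WGLasso.TendstoZeroInProb P
      (fun n ω => a n * WGLasso.opNormInf (J n ω) * lam n ω ^ 2 * s n *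
        √(deg n * Real.log ((m n : ℝ) + 1))))
    -- mixed-normal approximation of the initial estimator
    (hAMN : Tendsto
      (fun n => ⨆ y : Fin (m n) → ℝ,
        |WGLasso.orthantProb (P n)
            (fun ω => a n • (WGLasso.tildeJ (J n ω) (SigmaY n ω)⁻¹).mulVec
              (SigmaHat n ω - SigmaY n ω).vec) y -
          WGLasso.mixedNormalProb (P n)
            (fun ω => WGLasso.tildeJ (J n ω) (SigmaY n ω)⁻¹) (C n) y|)
      atTop (𝓝 0))
    -- `lim_{b ↓ 0} limsup_n P(min diag(J̃ C J̃ᵀ) < b) = 0`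
    (hDiag : Tendsto
      (fun b : ℝ => limsup
        (fun n => P n {ω | ∃ k : Fin (m n),
          (WGLasso.tildeJ (J n ω) (SigmaY n ω)⁻¹ * C n ω *
            (WGLasso.tildeJ (J n ω) (SigmaY n ω)⁻¹).transpose) k k < b}) atTop)
      (𝓝[>] 0) (𝓝 0)) :
    Tendsto
      (fun n => ⨆ y : Fin (m n) → ℝ,
        |WGLasso.orthantProb (P n)
            (fun ω => a n • (J n ω).mulVec
              (WGLasso.estimator (SigmaHat n ω) (lam n ω) -
                WGLasso.bias (SigmaHat n ω) (lam n ω) - (SigmaY n ω)⁻¹).vec) y -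
          WGLasso.mixedNormalProb (P n)
            (fun ω => WGLasso.tildeJ (J n ω) (SigmaY n ω)⁻¹) (C n) y|)
      atTop (𝓝 0) := by
  have hSigmaY_pd : ∀ n, ∀ᵐ ω ∂(P n), (SigmaY n ω).PosDef := fun n => by
    filter_upwards [(hSigmaY n).ae_posSemidef, hSigmaY_inv n] with ω h1 h2
    exact h1.posDef_iff_isUnit.2 h2
  have hprob : ∀ n (y : Fin (m n) → ℝ) (X : Ω n → Fin (m n) → ℝ)
      (A : Ω n → Matrix (Fin (m n)) (Fin (d n) × Fin (d n)) ℝ),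
      |WGLasso.orthantProb (P n) X y - WGLasso.mixedNormalProb (P n) A (C n) y| ≤ 1 := by
    intro n y X A
    unfold WGLasso.orthantProb WGLasso.mixedNormalProb
    rw [abs_le]
    constructor <;> linarith [measureReal_nonneg (μ := P n) (s := {ω | ∀ k, X ω k ≤ y k}),
      measureReal_le_one (μ := P n) (s := {ω | ∀ k, X ω k ≤ y k}),
      measureReal_nonneg (μ := (P n).prod (Measure.pi fun _ : Fin (d n) × Fin (d n) =>
        gaussianReal 0 1)) (s := {p | ∀ k, (A p.1 * CFC.sqrt (C n p.1)).mulVec p.2 k ≤ y k}),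
      measureReal_le_one (μ := (P n).prod (Measure.pi fun _ : Fin (d n) × Fin (d n) =>
        gaussianReal 0 1)) (s := {p | ∀ k, (A p.1 * CFC.sqrt (C n p.1)).mulVec p.2 k ≤ y k})]
  have hnn : ∀ n (f : (Fin (m n) → ℝ) → ℝ), 0 ≤ ⨆ y, |f y| := fun n f =>
    Real.iSup_nonneg fun y => abs_nonneg _
  rw [tendsto_order]
  refine ⟨fun b hb => Eventually.of_forall fun n => hb.trans_le (hnn n _), fun ε hε => ?_⟩
  obtain ⟨b, hb_lim, hb⟩ := ((hDiag.eventually_lt_const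
    (ENNReal.ofReal_pos.2 (by positivity : 0 < ε / 5))).and self_mem_nhdsWithin).exists
  have hb0 : 0 < b := hb
  set c := ε / 5 * √b / 45
  have hc : 0 < c := by positivity
  filter_upwards [eventually_lt_of_limsup_lt hb_lim,
    hAMN.eventually_lt_const (by positivity : 0 < ε / 5),
    WGLasso.linearization_error_negligible d hd SigmaY SigmaHat hSigmaY_pd hSigmaHat_psd
      hSigmaHat_diag s deg hs hdeg hEigen hSparse hDegree lam hlam_pos hEst hRate a ha m J hNegl hc
      (ENNReal.ofReal_pos.2 (by positivity : 0 < ε / 5))] with n h1 h2 h3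
  refine lt_of_le_of_lt (ciSup_le fun y => ?_) (by linarith : 4 * (ε / 5) < ε)
  rcases Nat.eq_zero_or_pos (m n) with hm | hm
  · have hempty : IsEmpty (Fin (m n)) := by rw [hm]; infer_instance
    simp only [WGLasso.orthantProb, WGLasso.mixedNormalProb, IsEmpty.forall_iff]
    simp
    positivity
  set L := √(Real.log ((m n : ℝ) + 1))
  have hL : 0 < L := Real.sqrt_pos.2 (Real.log_pos (by
    have : (0 : ℝ) < m n := by exact_mod_cast hm
    linarith))
  have hδ : 0 < c / L := by positivity
  have hmain := WGLasso.abs_orthantProb_sub_le (P := P n) (δ := c / L)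
    (X := fun ω => a n • (J n ω).mulVec
      (WGLasso.estimator (SigmaHat n ω) (lam n ω) -
        WGLasso.bias (SigmaHat n ω) (lam n ω) - (SigmaY n ω)⁻¹).vec)
    (Z := fun ω => a n • (WGLasso.tildeJ (J n ω) (SigmaY n ω)⁻¹).mulVec
      (SigmaHat n ω - SigmaY n ω).vec)
    (G := WGLasso.mixedNormalProb (P n)
      (fun ω => WGLasso.tildeJ (J n ω) (SigmaY n ω)⁻¹) (C n))
    (α := ε / 5) (β := ε / 5 + ε / 5) (η := ε / 5)
    (fun y => (le_ciSup (f := fun y => |WGLasso.orthantProb (P n)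
      (fun ω => a n • (WGLasso.tildeJ (J n ω) (SigmaY n ω)⁻¹).mulVec
        (SigmaHat n ω - SigmaY n ω).vec) y - WGLasso.mixedNormalProb (P n)
          (fun ω => WGLasso.tildeJ (J n ω) (SigmaY n ω)⁻¹) (C n) y|)
      ⟨1, by rintro _ ⟨y, rfl⟩; exact hprob n y _ _⟩ y).trans h2.le)
    (fun y => ?_) ?_ y
  · exact hmain.trans (by linarith)
  · refine (WGLasso.mixedNormalProb_add_le hm (WGLasso.measurable_tildeJ (hJ_meas n)
      (WGLasso.measurable_matrix_inv (hSigmaY_meas n))) (hC_meas n) (hC_psd n) hb0 hδ y).trans ?_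
    gcongr
    · refine le_of_eq ?_
      have hsb : √b ≠ 0 := (Real.sqrt_pos.2 hb0).ne'
      show 45 * L * (c / L / √b) = ε / 5
      simp only [c]
      field_simp
    · exact WGLasso.measureReal_le_of_le (by positivity) h1.le
  · refine WGLasso.measureReal_le_of_le (by positivity) ((measure_mono ?_).trans h3)
    rintro ω ⟨k, hk⟩ hall
    have h4 := hall k
    rw [div_lt_iff₀ hL] at hk
    linarith
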